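/- **Conventions.** A po-category is a category whose hom-sets are posets and whose composition is monotone in both arguments; a po-functor is a functor that is monotone on hom-posets; an isomorphism of po-categories is a po-functor with a strictly inverse po-functor. In a po-category a morphism $L:c\to d$ is left adjoint to $R:d\to c$ (composing in diagrammatic order) if $\mathrm{id}_c\le L\mathbin{;}R$ and $R\mathbin{;}L\le \mathrm{id}_d$. $\mathrm{LAdj}(\mathcal C)$ is the category with the objects of $\mathcal C$ and with those morphisms of $\mathcal C$ that have a right adjoint. $\mathbb{P}\mathrm{oset}$ is the po-category of posets and monotone maps (ordered pointwise), with its cartesian monoidal structure. A category is regular if it has finite limits, every kernel pair has a coequalizer, and regular epimorphisms are stable under pullback. The relations po-category $\mathbb{R}\mathrm{el}_{\mathcal R}$ of a regular category $\mathcal R$ has the objects of $\mathcal R$; its hom-posets are $\mathbb{R}\mathrm{el}_{\mathcal R}(r,s)=\mathrm{Sub}_{\mathcal R}(r\times s)$; the composite of $x\subseteq r\times s$ and $y\subseteq s\times t$ is the image in $r\times t$ of the pullback $x\times_s y$; identities are diagonals; and it is symmetric monoidal under the products of $\mathcal R$. A po-category is called a regular po-category if it is isomorphic to $\mathbb{R}\mathrm{el}_{\mathcal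 R}$ for some regular category $\mathcal R$. For a set $T$, let $\mathrm{FRg}(T)$ be the opposite of the comma category $\mathrm{FinSet}\downarrow\mathcal P_f(T)$: its objects (contexts) are triples $(n,S,\tau)$ with $n\in\mathbb N$, $S\subseteq T$ finite and $\tau:\{1,\dots,n\}\to S$, and a morphism $(n,S,\tau)\to(n',S',\tau')$ is a function $f:\{1,\dots,n'\}\to\{1,\dots,n\}$ with $\tau\circ f=\tau'$, where $S'\subseteq S$ is required. It is a regular category, with product $(n,S,\tau)\oplus(n',S',\tau')=(n+n',S\cup S',[\tau,\tau'])$. A regular calculus $(T,P)$ consists of a set $T$ and an ajax po-functor $P:\mathbb{R}\mathrm{el}_{\mathrm{FRg}(T)}\to\mathbb{P}\mathrm{oset}$, i.e. a lax symmetric monoidal po-functor whose laxators $1\to P(0)$ (where $0$ denotes the terminal context, the monoidal unit) and $\rho:P(\Gamma)\times P(\Gamma')\to P(\Gamma\oplus\Gamma')$ are right adjoints. For $f:\Gamma\to\Gamma'$ in $\mathrm{FRg}(T)$ write $f_!:=P(\langle \mathrm{id},f\rangle):P(\Gamma)\to P(\Gamma')$. Given a regular calculus $(T,P)$, the po-category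 $\mathbb{I}\mathrm{ntRel}_P$ of internal relations has as objects the pairs $(\Gamma,\varphi)$ with $\Gamma$ a context and $\varphi\in P(\Gamma)$, and as hom-posets $$\mathbb{I}\mathrm{ntRel}_P\big((\Gamma_1,\varphi_1),(\Gamma_2,\varphi_2)\big)=\{\theta\in P(\Gamma_1\oplus\Gamma_2)\mid(\pi_1)_!\theta\le\varphi_1,\ (\pi_2)_!\theta\le\varphi_2\}\subseteq P(\Gamma_1\oplus\Gamma_2).$$ The composite of $\theta\in P(\Gamma_1\oplus\Gamma_2)$ and $\eta\in P(\Gamma_2\oplus\Gamma_3)$ is $P(\mathrm{comp})(\rho(\theta,\eta))$, where $\mathrm{comp}$ is the relation from $(\Gamma_1\oplus\Gamma_2)\oplus(\Gamma_2\oplus\Gamma_3)$ to $\Gamma_1\oplus\Gamma_3$ given by the subobject $\Gamma_1\oplus\Gamma_2\oplus\Gamma_3$, embedded by $(a,b,c)\mapsto\big(((a,b),(b,c)),(a,c)\big)$. The identity of $(\Gamma,\varphi)$ is $\delta_!\varphi$, where $\delta:\Gamma\to\Gamma\oplus\Gamma$ is the diagonal. Put $\mathcal R_P:=\mathrm{LAdj}(\mathbb{I}\mathrm{ntRel}_P)$.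 **Corollary 7.21.** For every regular calculus $(T,P)$, the category $\mathcal R_P$ is regular, and the po-category $\mathbb{I}\mathrm{ntRel}_P$ is isomorphic to the relations po-category $\mathbb{R}\mathrm{el}_{\mathcal R_P}$. In particular, $\mathbb{I}\mathrm{ntRel}_P$ is a regular po-category. -/

import Mathlib

open CategoryTheory Limits MonoidalCategory CartesianMonoidalCategory

universe v u w v₁ u₁ v₂ u₂

namespace RegLogic

/-! ### Po-categories -/

/-- A po-category: a category enriched in posets. -/
class PoCategory (C : Type u) extends Category.{v} C where
  homOrder : ∀ X Y : C, PartialOrder (X ⟶ Y)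
  comp_mono : ∀ {X Y Z : C} {f f' : X ⟶ Y} {g g' : Y ⟶ Z}, f ≤ f' → g ≤ g' → f ≫ g ≤ f' ≫ g'

attribute [reducible, instance] PoCategory.homOrder

/-- `L` is left adjoint to `R` in a po-category: `𝟙 ≤ L ≫ R` and `R ≫ L ≤ 𝟙`
(the triangle identities are automatic, since there is at most one 2-cell between 1-cells). -/
def Adj {C : Type u} [PoCategory.{v} C] {c d : C} (L : c ⟶ d) (R : d ⟶ c) : Prop :=
  𝟙 c ≤ L ≫ R ∧ R ≫ L ≤ 𝟙 d

/-- A po-functor is a functor that preserves the order of the hom-posets. -/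
def IsPoFunctor {C : Type u₁} [PoCategory.{v₁} C] {D : Type u₂} [PoCategory.{v₂} D]
    (F : C ⥤ D) : Prop :=
  ∀ {X Y : C} {f g : X ⟶ Y}, f ≤ g → F.map f ≤ F.map g

/-- An isomorphism of po-categories: po-functors in both directions that are strictly inverse to
one another. -/
structure PoIso (C : Type u₁) [PoCategory.{v₁} C] (D : Type u₂) [PoCategory.{v₂} D] extends
    IsoCat C D where
  functor_po : IsPoFunctor functor
  inverse_po : IsPoFunctor inverse

/-- The po-category of posets: monotone maps are ordered pointwise. -/
instance : PoCategory PartOrd.{u} where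
  homOrder P Q := PartialOrder.lift (fun f : P ⟶ Q => f.hom) (fun _ _ h => PartOrd.hom_ext h)
  comp_mono {X Y Z f f' g g'} hf hg := by
    intro x
    exact (hg (f.hom x)).trans (g'.hom.monotone (hf x))

/-- The cartesian monoidal structure on posets: the product order on `P × Q`, with unit the
one-point poset. -/
instance : CartesianMonoidalCategory PartOrd.{u} :=
  .ofChosenFiniteProducts
    { cone := asEmptyCone (PartOrd.of PUnit.{u + 1})
      isLimit := IsTerminal.ofUniqueHom
        (fun _ => PartOrd.ofHom ⟨fun _ => PUnit.unit, fun _ _ _ => le_rfl⟩)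
        (fun _ _ => rfl) }
    (fun P Q =>
      { cone := BinaryFan.mk (P := PartOrd.of (P × Q))
          (PartOrd.ofHom ⟨Prod.fst, fun _ _ h => h.1⟩) (PartOrd.ofHom ⟨Prod.snd, fun _ _ h => h.2⟩)
        isLimit := BinaryFan.IsLimit.mk _
          (fun f g => PartOrd.ofHom
            ⟨fun x => (f x, g x), fun _ _ h => ⟨f.hom.monotone h, g.hom.monotone h⟩⟩)
          (fun _ _ => rfl) (fun _ _ => rfl)
          (fun f g m hf hg => by subst hf hg; rfl) })

instance : BraidedCategory PartOrd.{u} := .ofCartesianMonoidalCategory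

/-! ### The free regular category on a set -/

/-- A context over a set `T` of types: `n` variables, a finite support `S ⊆ T`, and a typing
`τ : n → S` of the variables. These are the objects of the free regular category on `T`. -/
structure FRg (T : Type u) where
  n : ℕ
  S : Finset T
  τ : Fin n → T
  mem : ∀ i, τ i ∈ S

namespace FRg

variable {T : Type u}

/-- A morphism of contexts `Γ ⟶ Δ` is a morphism from `Δ` to `Γ` in the comma category of finite
sets over finite subsets of `T`: a function between the sets of variables, in the opposite
direction, that preserves types, where the support of `Δ` is contained in that of `Γ`. -/
@[ext]
structure Hom (Γ Δ : FRg T) where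
  fn : Fin Δ.n → Fin Γ.n
  type_eq : ∀ i, Γ.τ (fn i) = Δ.τ i
  supp : Δ.S ⊆ Γ.S

instance : Category (FRg T) where
  Hom := Hom
  id Γ := ⟨id, fun _ => rfl, Finset.Subset.refl _⟩
  comp f g := ⟨f.fn ∘ g.fn, fun i => by simp [f.type_eq, g.type_eq], g.supp.trans f.supp⟩

theorem hom_ext' {Γ Δ : FRg T} {f g : Γ ⟶ Δ} (h : ∀ i, f.fn i = g.fn i) : f = g :=
  Hom.ext (funext h)

@[simp] theorem id_fn (Γ : FRg T) (i : Fin Γ.n) : Hom.fn (𝟙 Γ) i = i := rfl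

@[simp] theorem comp_fn {Γ Δ Ε : FRg T} (f : Γ ⟶ Δ) (g : Δ ⟶ Ε) (i : Fin Ε.n) :
    (f ≫ g).fn i = f.fn (g.fn i) := rfl

open Classical in
/-- The product of contexts: concatenation of the variables and union of the supports. -/
noncomputable def prod (Γ Δ : FRg T) : FRg T where
  n := Γ.n + Δ.n
  S := Γ.S ∪ Δ.S
  τ := Fin.append Γ.τ Δ.τ
  mem := Fin.addCases (fun i => by simp [Γ.mem i]) (fun i => by simp [Δ.mem i])

/-- The empty context. -/
def empty : FRg T := ⟨0, ∅, Fin.elim0, fun i => i.elim0⟩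

theorem subset_prod_left (Γ Δ : FRg T) : Γ.S ⊆ (prod Γ Δ).S := by
  classical exact Finset.subset_union_left

theorem subset_prod_right (Γ Δ : FRg T) : Δ.S ⊆ (prod Γ Δ).S := by
  classical exact Finset.subset_union_right

theorem prod_subset {Γ Δ : FRg T} {S : Finset T} (h₁ : Γ.S ⊆ S) (h₂ : Δ.S ⊆ S) :
    (prod Γ Δ).S ⊆ S := by
  classical exact Finset.union_subset h₁ h₂

noncomputable def prodFst (Γ Δ : FRg T) : prod Γ Δ ⟶ Γ :=
  ⟨Fin.castAdd Δ.n, fun i => by simp [prod], subset_prod_left Γ Δ⟩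

noncomputable def prodSnd (Γ Δ : FRg T) : prod Γ Δ ⟶ Δ :=
  ⟨Fin.natAdd Γ.n, fun i => by simp [prod], subset_prod_right Γ Δ⟩

noncomputable def prodLift {Ε Γ Δ : FRg T} (f : Ε ⟶ Γ) (g : Ε ⟶ Δ) : Ε ⟶ prod Γ Δ where
  fn := Fin.append f.fn g.fn
  type_eq := Fin.addCases (fun i => by simp [prod, f.type_eq])
    (fun i => by simp [prod, g.type_eq])
  supp := prod_subset f.supp g.supp

theorem prodLift_fst {Ε Γ Δ : FRg T} (f : Ε ⟶ Γ) (g : Ε ⟶ Δ) : prodLift f g ≫ prodFst Γ Δ = f :=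
  hom_ext' fun i => Fin.append_left _ _ i

theorem prodLift_snd {Ε Γ Δ : FRg T} (f : Ε ⟶ Γ) (g : Ε ⟶ Δ) : prodLift f g ≫ prodSnd Γ Δ = g :=
  hom_ext' fun i => Fin.append_right _ _ i

theorem prodLift_uniq {Ε Γ Δ : FRg T} (m : Ε ⟶ prod Γ Δ) :
    m = prodLift (m ≫ prodFst Γ Δ) (m ≫ prodSnd Γ Δ) := by
  refine hom_ext' (Fin.addCases (fun i => ?_) (fun i => ?_))
  · exact (Fin.append_left (m ≫ prodFst Γ Δ).fn (m ≫ prodSnd Γ Δ).fn i).symm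
  · exact (Fin.append_right (m ≫ prodFst Γ Δ).fn (m ≫ prodSnd Γ Δ).fn i).symm

/-- The cartesian monoidal structure of `FRg T`, given by the product of contexts and the empty
context. -/
noncomputable instance : CartesianMonoidalCategory (FRg T) :=
  .ofChosenFiniteProducts
    { cone := asEmptyCone empty
      isLimit := IsTerminal.ofUniqueHom
        (fun Γ => ⟨Fin.elim0, fun i => i.elim0, Finset.empty_subset _⟩)
        (fun _ _ => hom_ext' fun i => i.elim0) }
    (fun Γ Δ =>
      { cone := BinaryFan.mk (prodFst Γ Δ) (prodSnd Γ Δ)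
        isLimit := BinaryFan.IsLimit.mk _ prodLift prodLift_fst prodLift_snd
          (fun f g m hf hg => by subst hf hg; exact prodLift_uniq m) })

/-! The free regular category has finite limits and is regular. -/

/-- The context on an arbitrary finite type of variables. -/
noncomputable def ofFinite {α : Type} [Finite α] (τ : α → T) (S : Finset T)
    (h : ∀ a, τ a ∈ S) : FRg T :=
  ⟨Nat.card α, S, fun i => τ ((Finite.equivFin α).symm i), fun _ => h _⟩

theorem hasEqualizer {Γ Δ : FRg T} (f g : Γ ⟶ Δ) : HasEqualizer f g := by
  let s : Setoid (Fin Γ.n) := Relation.EqvGen.setoid (fun a b => ∃ i, a = f.fn i ∧ b = g.fn i)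
  have hτ : ∀ a b, s a b → Γ.τ a = Γ.τ b := by
    intro a b h
    induction h with
    | rel a b h => obtain ⟨i, rfl, rfl⟩ := h; rw [f.type_eq, g.type_eq]
    | refl => rfl
    | symm _ _ _ ih => exact ih.symm
    | trans _ _ _ _ _ ih₁ ih₂ => exact ih₁.trans ih₂
  let E : FRg T := ofFinite (Quotient.lift Γ.τ hτ) Γ.S (fun a => by
    induction a using Quotient.inductionOn; exact Γ.mem _)
  let ι : E ⟶ Γ := ⟨fun a => Finite.equivFin (Quotient s) ⟦a⟧, fun i => by simp [E, ofFinite],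
    Finset.Subset.refl _⟩
  have w : ι ≫ f = ι ≫ g := hom_ext' fun i => by
    simp only [comp_fn, ι]
    exact congrArg _ (Quotient.sound (Relation.EqvGen.rel _ _ ⟨i, rfl, rfl⟩))
  refine ⟨⟨⟨Fork.ofι ι w, Fork.IsLimit.mk' _ (fun t => ?_)⟩⟩⟩
  have ht : ∀ a b, s a b → t.ι.fn a = t.ι.fn b := by
    intro a b h
    induction h with
    | rel a b h =>
      obtain ⟨i, rfl, rfl⟩ := h
      exact congrFun (congrArg Hom.fn t.condition) i
    | refl => rfl
    | symm _ _ _ ih => exact ih.symm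
    | trans _ _ _ _ _ ih₁ ih₂ => exact ih₁.trans ih₂
  refine ⟨⟨fun i => Quotient.lift t.ι.fn ht ((Finite.equivFin (Quotient s)).symm i), fun i => ?_,
    t.ι.supp⟩, ?_, fun {m} hm => ?_⟩
  · change _ = Quotient.lift Γ.τ hτ _
    induction (Finite.equivFin (Quotient s)).symm i using Quotient.inductionOn
    exact t.ι.type_eq _
  · exact hom_ext' fun i => by simp [ι]
  · refine hom_ext' fun i => ?_
    obtain ⟨q, rfl⟩ := (Finite.equivFin (Quotient s)).surjective i
    induction q using Quotient.inductionOn with | h a => ?_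
    have := congrFun (congrArg Hom.fn hm) a
    simpa [ι] using this

instance : HasEqualizers (FRg T) :=
  haveI : ∀ {Γ Δ : FRg T} {f g : Γ ⟶ Δ}, HasLimit (parallelPair f g) :=
    fun {_ _ f g} => hasEqualizer f g
  hasEqualizers_of_hasLimit_parallelPair _

instance : HasFiniteLimits (FRg T) :=
  hasFiniteLimits_of_hasEqualizers_and_finite_products

/-- The coequalizer of `f` and `g`: the variables on which `f` and `g` agree. -/
noncomputable def coeq {Γ Δ : FRg T} (f g : Γ ⟶ Δ) : FRg T :=
  ofFinite (fun a : {a // f.fn a = g.fn a} => Δ.τ a) Δ.S (fun _ => Δ.mem _)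

noncomputable def coeqπ {Γ Δ : FRg T} (f g : Γ ⟶ Δ) : Δ ⟶ coeq f g :=
  ⟨fun i => (Finite.equivFin {a // f.fn a = g.fn a}).symm i, fun _ => rfl, Finset.Subset.refl _⟩

theorem coeq_condition {Γ Δ : FRg T} (f g : Γ ⟶ Δ) : f ≫ coeqπ f g = g ≫ coeqπ f g :=
  hom_ext' fun i => ((Finite.equivFin {a // f.fn a = g.fn a}).symm i).2

theorem coeqπ_injective {Γ Δ : FRg T} (f g : Γ ⟶ Δ) : Function.Injective (coeqπ f g).fn :=
  fun _ _ h => (Finite.equivFin _).symm.injective (Subtype.ext h)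

/-- The map out of the coequalizer induced by a map that coequalizes `f` and `g`. -/
noncomputable def coeqDesc {Γ Δ Ε : FRg T} (f g : Γ ⟶ Δ) (k : Δ ⟶ Ε) (hk : f ≫ k = g ≫ k) :
    coeq f g ⟶ Ε where
  fn i := Finite.equivFin {a // f.fn a = g.fn a} ⟨k.fn i, congrFun (congrArg Hom.fn hk) i⟩
  type_eq i := by simpa [coeq, ofFinite] using k.type_eq i
  supp := k.supp

theorem coeqπ_desc {Γ Δ Ε : FRg T} (f g : Γ ⟶ Δ) (k : Δ ⟶ Ε) (hk : f ≫ k = g ≫ k) :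
    coeqπ f g ≫ coeqDesc f g k hk = k :=
  hom_ext' fun i => by simp [coeqπ, coeqDesc]

/-- The coequalizer in `FRg T`. -/
noncomputable def isColimitCoeq {Γ Δ : FRg T} (f g : Γ ⟶ Δ) :
    IsColimit (Cofork.ofπ (coeqπ f g) (coeq_condition f g)) :=
  Cofork.IsColimit.mk' _ fun t => ⟨coeqDesc f g t.π t.condition, coeqπ_desc f g _ _, fun hm =>
    hom_ext' fun i => coeqπ_injective f g <|
      congrFun (congrArg Hom.fn (hm.trans (coeqπ_desc f g t.π t.condition).symm)) i⟩

instance : HasCoequalizers (FRg T) :=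
  haveI : ∀ {Γ Δ : FRg T} {f g : Γ ⟶ Δ}, HasColimit (parallelPair f g) :=
    fun {_ _ f g} => ⟨⟨⟨_, isColimitCoeq f g⟩⟩⟩
  hasCoequalizers_of_hasColimit_parallelPair _

/-- The map `Γ ⊕ Γ ⟶ Γ` that is dual to the function which sends the variables satisfying `p` to the
first copy and the others to the second one. -/
noncomputable def fold {Γ : FRg T} (p : Fin Γ.n → Prop) : prod Γ Γ ⟶ Γ := by
  classical exact
  ⟨fun a => if p a then (prodFst Γ Γ).fn a else (prodSnd Γ Γ).fn a,
    fun i => by split_ifs; exacts [(prodFst Γ Γ).type_eq i, (prodSnd Γ Γ).type_eq i],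
    subset_prod_left Γ Γ⟩

theorem fold_iff {Γ : FRg T} (p : Fin Γ.n → Prop) (a : Fin Γ.n) :
    (prodFst Γ Γ).fn a = (fold p).fn a ↔ p a := by
  by_cases h : p a
  · simp [fold, h]
  · simp only [fold, h, if_false, iff_false]
    intro h'
    have h₁ := congrArg Fin.val h'
    have h₂ := a.2
    simp [prodFst, prodSnd] at h₁
    omega

theorem isRegularEpi_iff {Γ Δ : FRg T} (f : Γ ⟶ Δ) :
    IsRegularEpi f ↔ Function.Injective f.fn ∧ Δ.S = Γ.S := by
  constructor
  · rintro ⟨⟨h⟩⟩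
    let d := coeqDesc h.left h.right f h.w
    have hd : coeqπ h.left h.right ≫ d = f := coeqπ_desc _ _ _ _
    obtain ⟨d', hd' : f ≫ d' = _⟩ := Cofork.IsColimit.desc' h.isColimit
      (coeqπ h.left h.right) (coeq_condition _ _)
    have hdd : d' ≫ d = 𝟙 Δ := by
      refine Cofork.IsColimit.hom_ext h.isColimit ?_
      change f ≫ d' ≫ d = f ≫ 𝟙 _
      rw [← Category.assoc, hd', hd, Category.comp_id]
    refine ⟨?_, subset_antisymm f.supp d'.supp⟩
    have h₁ : Function.Injective d.fn := Function.LeftInverse.injective (g := d'.fn)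
      (fun i => congrFun (congrArg Hom.fn hdd) i)
    have h₂ : f.fn = (coeqπ h.left h.right).fn ∘ d.fn := (congrArg Hom.fn hd).symm
    rw [h₂]
    exact (coeqπ_injective _ _).comp h₁
  · rintro ⟨hf, hS⟩
    have w : prodFst Γ Γ ≫ f = fold (· ∈ Set.range f.fn) ≫ f :=
      hom_ext' fun i => (fold_iff _ _).2 ⟨i, rfl⟩
    refine ⟨⟨⟨_, prodFst Γ Γ, _, w, Cofork.IsColimit.mk' _ fun t => ?_⟩⟩⟩
    have ht : ∀ i, ∃ j, f.fn j = t.π.fn i := fun i =>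
      (fold_iff _ _).1 (congrFun (congrArg Hom.fn t.condition) i)
    choose k hk using ht
    refine ⟨⟨k, fun i => ?_, ?_⟩, hom_ext' hk, fun {m} hm => hom_ext' fun i => hf ?_⟩
    · change Δ.τ (k i) = _
      rw [← f.type_eq, hk, t.π.type_eq]
    · change _ ⊆ Δ.S
      exact hS ▸ t.π.supp
    · exact (congrFun (congrArg Hom.fn hm) i).trans (hk i).symm

instance : Regular (FRg T) where
  hasCoequalizer_of_isKernelPair _ := inferInstance
  regularEpiIsStableUnderBaseChange := by
    constructor
    intro X Y Y' S f g f' g' sq hg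
    rw [MorphismProperty.regularEpi_iff, isRegularEpi_iff] at *
    obtain ⟨hg, hS⟩ := hg
    classical
    let v : prod X Y ⟶ Y :=
      ⟨fun b => if h : ∃ c, g.fn c = b then (prodFst X Y).fn (f.fn h.choose)
        else (prodSnd X Y).fn b, fun b => by
          split_ifs with h
          · rw [(prodFst X Y).type_eq, f.type_eq, ← g.type_eq, h.choose_spec]
          · exact (prodSnd X Y).type_eq b, subset_prod_right X Y⟩
    have w : v ≫ g = prodFst X Y ≫ f := hom_ext' fun c => by
      have h : ∃ c', g.fn c' = g.fn c := ⟨c, rfl⟩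
      change dite _ _ _ = _
      rw [dif_pos h, hg h.choose_spec]; rfl
    have hl : sq.lift v (prodFst X Y) w ≫ g' = prodFst X Y := sq.lift_snd _ _ _
    refine ⟨fun a b hab => ?_, subset_antisymm g'.supp
      ((sq.lift v (prodFst X Y) w).supp.trans ?_)⟩
    · have : (prodFst X Y).fn a = (prodFst X Y).fn b := by
        rw [← hl, comp_fn, comp_fn, hab]
      exact Fin.castAdd_injective _ _ this
    · exact prod_subset (Finset.Subset.refl _) (hS ▸ f.supp)

end FRg


/-! ### The relations po-category of a regular category -/

/-- The objects of the relations po-category of `C` are those of `C`. -/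
@[ext]
structure Rel (C : Type u) where
  as : C

namespace Rel

section Covers

theorem mk_factors {C : Type u} [Category.{v} C] {A X U : C} (m : A ⟶ X) [Mono m] (f : U ⟶ X) :
    (Subobject.mk m).Factors f ↔ ∃ k : U ⟶ A, k ≫ m = f := Subobject.mk_factors_iff m f

theorem factors_of_cover {C : Type u} [Category.{v} C] {U U' X : C} (x : Subobject X) (e : U' ⟶ U)
    [StrongEpi e] (f : U ⟶ X) (h : x.Factors (e ≫ f)) : x.Factors f := by
  have sq : CommSq (x.factorThru _ h) e x.arrow f := ⟨by simp⟩
  rw [← sq.fac_right]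
  exact Subobject.factors_comp_arrow _

variable {C : Type u} [Category.{v} C] [Regular C]

theorem exists_cover_pullback {U U' V : C} (e : U' ⟶ U) [StrongEpi e] (f : V ⟶ U) :
    ∃ (V' : C) (e' : V' ⟶ V) (f' : V' ⟶ U'), StrongEpi e' ∧ f' ≫ e = e' ≫ f := by
  have : IsRegularEpi e := Regular.isRegularEpi_of_extremalEpi e
  exact ⟨_, pullback.snd e f, pullback.fst e f, inferInstance, pullback.condition⟩

theorem imageSubobject_factors_iff {U A X : C} (h : A ⟶ X) (f : U ⟶ X) :
    (imageSubobject h).Factors f ↔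
      ∃ (U' : C) (e : U' ⟶ U) (a : U' ⟶ A), StrongEpi e ∧ a ≫ h = e ≫ f := by
  constructor
  · intro hf
    have : StrongEpi (factorThruImageSubobject h) := by
      unfold factorThruImageSubobject; infer_instance
    obtain ⟨U', e, a, he, ha⟩ := exists_cover_pullback (factorThruImageSubobject h)
      ((imageSubobject h).factorThru f hf)
    refine ⟨U', e, a, he, ?_⟩
    have ha' := congrArg (· ≫ (imageSubobject h).arrow) ha
    simpa only [Category.assoc, imageSubobject_arrow_comp, Subobject.factorThru_arrow] using ha'
  · rintro ⟨U', e, a, he, ha⟩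
    refine factors_of_cover _ e f ?_
    rw [← ha]
    refine (congrArg (imageSubobject h).Factors ?_).mp (Subobject.factors_comp_arrow
      (P := imageSubobject h) (a ≫ factorThruImageSubobject h))
    rw [Category.assoc, imageSubobject_arrow_comp]

end Covers

section Sub

variable {C : Type u} [Category.{v} C] [CartesianMonoidalCategory C]

/-- The graph `⟨𝟙, f⟩` of a morphism, as a subobject of the product. -/
noncomputable def graphSub {X Y : C} (f : X ⟶ Y) : Subobject (X ⊗ Y) := Subobject.mk (lift (𝟙 X) f)

theorem factors_graphSub {X Y U : C} (f : X ⟶ Y) (a : U ⟶ X) (b : U ⟶ Y) :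
    (graphSub f).Factors (lift a b) ↔ a ≫ f = b := by
  rw [graphSub, mk_factors]
  constructor
  · rintro ⟨k, hk⟩
    have h₁ := congrArg (· ≫ fst _ _) hk
    have h₂ := congrArg (· ≫ snd _ _) hk
    simp at h₁ h₂
    rw [← h₁, h₂]
  · rintro rfl
    exact ⟨a, by simp⟩

theorem sub_le_iff {X Y : C} {x y : Subobject (X ⊗ Y)} :
    x ≤ y ↔ ∀ ⦃U : C⦄ (a : U ⟶ X) (b : U ⟶ Y), x.Factors (lift a b) → y.Factors (lift a b) := by
  constructor
  · intro h U a b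
    exact Subobject.factors_of_le _ h
  · intro h
    apply Subobject.le_of_factors
    have := h (x.arrow ≫ fst _ _) (x.arrow ≫ snd _ _)
    rw [lift_comp_fst_snd] at this
    exact this x.factors_self

theorem sub_ext {X Y : C} {x y : Subobject (X ⊗ Y)}
    (h : ∀ ⦃U : C⦄ (a : U ⟶ X) (b : U ⟶ Y), x.Factors (lift a b) ↔ y.Factors (lift a b)) : x = y :=
  le_antisymm (sub_le_iff.2 fun _ a b => (h a b).1) (sub_le_iff.2 fun _ a b => (h a b).2)

theorem factors_precomp {X Y U V : C} {x : Subobject (X ⊗ Y)} (f : V ⟶ U) {a : U ⟶ X} {b : U ⟶ Y}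
    (h : x.Factors (lift a b)) : x.Factors (lift (f ≫ a) (f ≫ b)) := by
  rw [← comp_lift]
  exact Subobject.factors_of_factors_right _ h

theorem factors_local {X Y U U' : C} {x : Subobject (X ⊗ Y)} (e : U' ⟶ U) [StrongEpi e] {a : U ⟶ X}
    {b : U ⟶ Y} (h : x.Factors (lift (e ≫ a) (e ≫ b))) : x.Factors (lift a b) := by
  rw [← comp_lift] at h
  exact factors_of_cover _ e _ h

/-- The product `x × y`, seen as a monomorphism into `(X × X') × (Y × Y')`. -/
noncomputable def tensorArrow {X Y X' Y' : C} (x : Subobject (X ⊗ Y)) (y : Subobject (X' ⊗ Y')) :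
    (x : C) ⊗ (y : C) ⟶ (X ⊗ X') ⊗ (Y ⊗ Y') :=
  lift ((x.arrow ≫ fst X Y) ⊗ₘ (y.arrow ≫ fst X' Y')) ((x.arrow ≫ snd X Y) ⊗ₘ (y.arrow ≫ snd X' Y'))

theorem comp_tensorArrow {X Y X' Y' U : C} (x : Subobject (X ⊗ Y)) (y : Subobject (X' ⊗ Y'))
    (k : U ⟶ (x : C) ⊗ (y : C)) : k ≫ tensorArrow x y =
      lift (lift ((k ≫ fst _ _) ≫ x.arrow ≫ fst X Y) ((k ≫ snd _ _) ≫ y.arrow ≫ fst X' Y'))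
        (lift ((k ≫ fst _ _) ≫ x.arrow ≫ snd X Y) ((k ≫ snd _ _) ≫ y.arrow ≫ snd X' Y')) := by
  ext <;> simp [tensorArrow]

instance {X Y X' Y' : C} (x : Subobject (X ⊗ Y)) (y : Subobject (X' ⊗ Y')) :
    Mono (tensorArrow x y) where
  right_cancellation {U} f g h := by
    rw [comp_tensorArrow, comp_tensorArrow] at h
    have h₁ := congrArg (· ≫ fst _ _ ≫ fst _ _) h
    have h₂ := congrArg (· ≫ fst _ _ ≫ snd _ _) h
    have h₃ := congrArg (· ≫ snd _ _ ≫ fst _ _) h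
    have h₄ := congrArg (· ≫ snd _ _ ≫ snd _ _) h
    simp only [lift_fst_assoc, lift_snd_assoc, lift_fst, lift_snd] at h₁ h₂ h₃ h₄
    refine CartesianMonoidalCategory.hom_ext _ _ ?_ ?_
    · rw [← cancel_mono x.arrow]
      refine CartesianMonoidalCategory.hom_ext _ _ ?_ ?_
      · simpa only [Category.assoc] using h₁
      · simpa only [Category.assoc] using h₃
    · rw [← cancel_mono y.arrow]
      refine CartesianMonoidalCategory.hom_ext _ _ ?_ ?_
      · simpa only [Category.assoc] using h₂
      · simpa only [Category.assoc] using h₄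

end Sub

variable {C : Type u} [Category.{v} C] [CartesianMonoidalCategory C] [Regular C]

/-- The composite of relations: the image in `X ⊗ Z` of the pullback of `x` and `y` over `Y`. -/
noncomputable def compSub {X Y Z : C} (x : Subobject (X ⊗ Y)) (y : Subobject (Y ⊗ Z)) :
    Subobject (X ⊗ Z) :=
  imageSubobject (lift
    (pullback.fst (x.arrow ≫ snd X Y) (y.arrow ≫ fst Y Z) ≫ x.arrow ≫ fst X Y)
    (pullback.snd (x.arrow ≫ snd X Y) (y.arrow ≫ fst Y Z) ≫ y.arrow ≫ snd Y Z))

theorem factors_compSub {X Y Z U : C} (x : Subobject (X ⊗ Y)) (y : Subobject (Y ⊗ Z))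
    (a : U ⟶ X) (c : U ⟶ Z) :
    (compSub x y).Factors (lift a c) ↔ ∃ (U' : C) (e : U' ⟶ U) (b : U' ⟶ Y), StrongEpi e ∧
      x.Factors (lift (e ≫ a) b) ∧ y.Factors (lift b (e ≫ c)) := by
  rw [compSub, imageSubobject_factors_iff]
  constructor
  · rintro ⟨U', e, k, he, hk⟩
    rw [comp_lift, comp_lift] at hk
    have h₁ := congrArg (· ≫ fst _ _) hk
    have h₂ := congrArg (· ≫ snd _ _) hk
    simp only [lift_fst, lift_snd] at h₁ h₂
    refine ⟨U', e, k ≫ pullback.fst _ _ ≫ x.arrow ≫ snd X Y, he, ?_, ?_⟩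
    · rw [← h₁]
      convert Subobject.factors_comp_arrow (P := x) (k ≫ pullback.fst _ _) using 1
      ext <;> simp
    · rw [← h₂, pullback.condition]
      convert Subobject.factors_comp_arrow (P := y) (k ≫ pullback.snd _ _) using 1
      ext <;> simp
  · rintro ⟨U', e, b, he, hx, hy⟩
    have h₁ := x.factorThru_arrow _ hx
    have h₂ := y.factorThru_arrow _ hy
    refine ⟨U', e, pullback.lift (x.factorThru _ hx) (y.factorThru _ hy) (by simp), he, ?_⟩
    rw [comp_lift, comp_lift, pullback.lift_fst_assoc, pullback.lift_snd_assoc,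
      ← Category.assoc (x.factorThru _ hx), ← Category.assoc (y.factorThru _ hy), h₁, h₂, lift_fst,
      lift_snd]

theorem compSub_assoc {W X Y Z : C} (x : Subobject (W ⊗ X)) (y : Subobject (X ⊗ Y))
    (z : Subobject (Y ⊗ Z)) : compSub (compSub x y) z = compSub x (compSub y z) := by
  apply sub_ext
  intro U a d
  simp only [factors_compSub]
  constructor
  · rintro ⟨U', e, c, he, ⟨U'', e', b, he', hx, hy⟩, hz⟩
    refine ⟨U'', e' ≫ e, b, strongEpi_comp _ _, by simpa using hx, U'', 𝟙 _, e' ≫ c, inferInstance,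
      by simpa using hy, by simpa using factors_precomp e' hz⟩
  · rintro ⟨U', e, b, he, hx, U'', e', c, he', hy, hz⟩
    refine ⟨U'', e' ≫ e, c, strongEpi_comp _ _, ⟨U'', 𝟙 _, e' ≫ b, inferInstance,
      by simpa using factors_precomp e' hx, by simpa using hy⟩, by simpa using hz⟩

theorem factors_graphSub_comp {X Y Z U : C} (f : X ⟶ Y) (y : Subobject (Y ⊗ Z)) (a : U ⟶ X)
    (c : U ⟶ Z) : (compSub (graphSub f) y).Factors (lift a c) ↔ y.Factors (lift (a ≫ f) c) := by
  simp only [factors_compSub, factors_graphSub]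
  constructor
  · rintro ⟨U', e, b, he, rfl, h⟩
    rw [Category.assoc] at h
    exact factors_local e h
  · intro h
    exact ⟨U, 𝟙 U, a ≫ f, inferInstance, by simp, by simpa using h⟩

theorem graphSub_id_comp {X Y : C} (x : Subobject (X ⊗ Y)) : compSub (graphSub (𝟙 X)) x = x :=
  sub_ext fun U a b => by rw [factors_graphSub_comp, Category.comp_id]

theorem comp_graphSub_id {X Y : C} (x : Subobject (X ⊗ Y)) : compSub x (graphSub (𝟙 Y)) = x := by
  refine sub_ext fun U a c => ?_
  simp only [factors_compSub, factors_graphSub, Category.comp_id]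
  constructor
  · rintro ⟨U', e, b, he, h, rfl⟩
    exact factors_local e h
  · intro h
    exact ⟨U, 𝟙 U, c, inferInstance, by simpa using h, by simp⟩

/-- The po-category of relations in a regular category: a morphism from `X` to `Y` is a subobject of
`X ⊗ Y`, the order is the order of subobjects, the identities are the diagonals. -/
noncomputable instance : PoCategory (Rel C) where
  Hom X Y := Subobject (X.as ⊗ Y.as)
  id X := graphSub (𝟙 X.as)
  comp x y := compSub x y
  id_comp x := graphSub_id_comp x
  comp_id x := comp_graphSub_id x
  assoc x y z := compSub_assoc x y z
  homOrder X Y := inferInstanceAs (PartialOrder (Subobject (X.as ⊗ Y.as)))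
  comp_mono {X Y Z x x' y y'} hx hy := sub_le_iff.2 fun U a c h => by
    rw [factors_compSub] at h ⊢
    obtain ⟨U', e, b, he, h₁, h₂⟩ := h
    exact ⟨U', e, b, he, Subobject.factors_of_le _ hx h₁, Subobject.factors_of_le _ hy h₂⟩

/-- The generalized elements `a` and `b` are related by `x`. -/
def Mem {X Y : Rel C} (x : X ⟶ Y) {U : C} (a : U ⟶ X.as) (b : U ⟶ Y.as) : Prop :=
  Subobject.Factors (show Subobject (X.as ⊗ Y.as) from x) (lift a b)

theorem le_iff {X Y : Rel C} {x y : X ⟶ Y} :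
    x ≤ y ↔ ∀ ⦃U : C⦄ (a : U ⟶ X.as) (b : U ⟶ Y.as), Mem x a b → Mem y a b := sub_le_iff

theorem ext_mem {X Y : Rel C} {x y : X ⟶ Y}
    (h : ∀ ⦃U : C⦄ (a : U ⟶ X.as) (b : U ⟶ Y.as), Mem x a b ↔ Mem y a b) : x = y := sub_ext h

theorem Mem.precomp {X Y : Rel C} {x : X ⟶ Y} {U V : C} (f : V ⟶ U) {a : U ⟶ X.as} {b : U ⟶ Y.as}
    (h : Mem x a b) : Mem x (f ≫ a) (f ≫ b) := factors_precomp f h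

theorem Mem.of_cover {X Y : Rel C} {x : X ⟶ Y} {U U' : C} (e : U' ⟶ U) [StrongEpi e] {a : U ⟶ X.as}
    {b : U ⟶ Y.as} (h : Mem x (e ≫ a) (e ≫ b)) : Mem x a b := factors_local e h

theorem mem_comp {X Y Z : Rel C} {x : X ⟶ Y} {y : Y ⟶ Z} {U : C} {a : U ⟶ X.as} {c : U ⟶ Z.as} :
    Mem (x ≫ y) a c ↔ ∃ (U' : C) (e : U' ⟶ U) (b : U' ⟶ Y.as), StrongEpi e ∧
      Mem x (e ≫ a) b ∧ Mem y b (e ≫ c) := factors_compSub _ _ _ _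

@[simp] theorem mem_id {X : Rel C} {U : C} {a b : U ⟶ X.as} : Mem (𝟙 X) a b ↔ a = b := by
  refine (factors_graphSub _ _ _).trans ?_
  rw [Category.comp_id]

/-- The graph `⟨𝟙, f⟩` of a morphism, as a relation. -/
noncomputable def graph {X Y : C} (f : X ⟶ Y) : Rel.mk X ⟶ Rel.mk Y :=
  graphSub f

/-- The co-graph `⟨f, 𝟙⟩` of a morphism. -/
noncomputable def cograph {X Y : C} (f : X ⟶ Y) : Rel.mk Y ⟶ Rel.mk X :=
  (Subobject.mk (lift f (𝟙 X)) : Subobject (Y ⊗ X))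

@[simp] theorem mem_graph {X Y U : C} {f : X ⟶ Y} {a : U ⟶ X} {b : U ⟶ Y} :
    Mem (graph f) a b ↔ a ≫ f = b := factors_graphSub f a b

@[simp] theorem mem_cograph {X Y U : C} {f : X ⟶ Y} {a : U ⟶ X} {b : U ⟶ Y} :
    Mem (cograph f) b a ↔ a ≫ f = b := by
  refine (mk_factors _ _).trans ?_
  constructor
  · rintro ⟨k, hk⟩
    have h₁ := congrArg (· ≫ fst _ _) hk
    have h₂ := congrArg (· ≫ snd _ _) hk
    simp at h₁ h₂
    rw [← h₁, h₂]
  · rintro rfl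
    exact ⟨a, by simp⟩

@[simp] theorem mem_graph_comp {X Y U : C} {Z : Rel C} {f : X ⟶ Y} {y : Rel.mk Y ⟶ Z} {a : U ⟶ X}
    {c : U ⟶ Z.as} : Mem (graph f ≫ y) a c ↔ Mem y (a ≫ f) c := factors_graphSub_comp _ _ _ _

@[simp] theorem mem_comp_cograph {X Y U : C} {W : Rel C} {f : X ⟶ Y} {x : W ⟶ Rel.mk Y}
    {a : U ⟶ W.as} {c : U ⟶ X} : Mem (x ≫ cograph f) a c ↔ Mem x a (c ≫ f) := by
  rw [mem_comp]
  constructor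
  · rintro ⟨U', e, b, he, h, h'⟩
    rw [mem_cograph] at h'
    rw [← h', Category.assoc] at h
    exact h.of_cover e
  · intro h
    exact ⟨U, 𝟙 U, c ≫ f, inferInstance, by simpa using h, by simp⟩

@[simp] theorem graph_id (X : C) : graph (𝟙 X) = 𝟙 (Rel.mk X) := rfl

theorem graph_comp {X Y Z : C} (f : X ⟶ Y) (g : Y ⟶ Z) : graph (f ≫ g) = graph f ≫ graph g :=
  ext_mem fun U a b => by
    rw [mem_graph_comp]
    exact mem_graph.trans (by rw [← Category.assoc]; exact mem_graph.symm)

theorem graph_iso_hom {X Y : C} (e : X ≅ Y) : graph e.hom = cograph e.inv :=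
  ext_mem fun U a b => by
    refine mem_graph.trans (Iff.trans ?_ mem_cograph.symm)
    rw [Iso.comp_inv_eq, eq_comm]

/-- An isomorphism of `C`, as an isomorphism of relations. -/
@[simps]
noncomputable def graphIso {X Y : C} (e : X ≅ Y) : Rel.mk X ≅ Rel.mk Y where
  hom := graph e.hom
  inv := graph e.inv
  hom_inv_id := by rw [← graph_comp, e.hom_inv_id]; rfl
  inv_hom_id := by rw [← graph_comp, e.inv_hom_id]; rfl

/-! The symmetric monoidal structure that the relations inherit from the products of `C`. -/

/-- The product of relations. -/
noncomputable def tensor {X Y X' Y' : Rel C} (x : X ⟶ Y) (y : X' ⟶ Y') :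
    Rel.mk (X.as ⊗ X'.as) ⟶ Rel.mk (Y.as ⊗ Y'.as) :=
  (Subobject.mk (tensorArrow (X := X.as) (Y := Y.as) (X' := X'.as) (Y' := Y'.as) x y) :
    Subobject ((X.as ⊗ X'.as) ⊗ (Y.as ⊗ Y'.as)))

theorem mem_tensor {X Y X' Y' : Rel C} {x : X ⟶ Y} {y : X' ⟶ Y'} {U : C}
    {a : U ⟶ X.as ⊗ X'.as} {b : U ⟶ Y.as ⊗ Y'.as} :
    Mem (tensor x y) a b ↔
      Mem x (a ≫ fst _ _) (b ≫ fst _ _) ∧ Mem y (a ≫ snd _ _) (b ≫ snd _ _) := by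
  change Subobject (X.as ⊗ Y.as) at x
  change Subobject (X'.as ⊗ Y'.as) at y
  refine (mk_factors _ _).trans ?_
  constructor
  · rintro ⟨k, hk⟩
    rw [comp_tensorArrow] at hk
    have h₁ := congrArg (· ≫ fst _ _) hk
    have h₂ := congrArg (· ≫ snd _ _) hk
    simp only [lift_fst, lift_snd] at h₁ h₂
    subst h₁ h₂
    simp only [lift_fst, lift_snd]
    constructor
    · refine (congrArg (Subobject.Factors x) ?_).mp
        (Subobject.factors_comp_arrow (P := x) (k ≫ fst _ _))
      ext <;> simp
    · refine (congrArg (Subobject.Factors y) ?_).mp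
        (Subobject.factors_comp_arrow (P := y) (k ≫ snd _ _))
      ext <;> simp
  · rintro ⟨hx, hy⟩
    refine ⟨lift (x.factorThru _ hx) (y.factorThru _ hy), ?_⟩
    have h₁ := x.factorThru_arrow _ hx
    have h₂ := y.factorThru_arrow _ hy
    rw [comp_tensorArrow, lift_fst, lift_snd, ← Category.assoc, h₁, ← Category.assoc, h₂,
      ← Category.assoc, h₁, ← Category.assoc, h₂]
    ext <;> simp

noncomputable instance : MonoidalCategoryStruct (Rel C) where
  tensorObj X Y := ⟨X.as ⊗ Y.as⟩
  tensorHom x y := tensor x y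
  whiskerLeft X _ _ y := tensor (𝟙 X) y
  whiskerRight x Y := tensor x (𝟙 Y)
  tensorUnit := ⟨𝟙_ C⟩
  associator X Y Z := graphIso (α_ X.as Y.as Z.as)
  leftUnitor X := graphIso (λ_ X.as)
  rightUnitor X := graphIso (ρ_ X.as)

@[simp] theorem tensorObj_as (X Y : Rel C) : (X ⊗ Y).as = X.as ⊗ Y.as := rfl

theorem mem_tensorHom {X Y X' Y' : Rel C} {x : X ⟶ Y} {y : X' ⟶ Y'} {U : C}
    {a : U ⟶ X.as ⊗ X'.as} {b : U ⟶ Y.as ⊗ Y'.as} :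
    Mem (x ⊗ₘ y) a b ↔
      Mem x (a ≫ fst _ _) (b ≫ fst _ _) ∧ Mem y (a ≫ snd _ _) (b ≫ snd _ _) := mem_tensor

theorem graph_tensorHom {X Y X' Y' : C} (f : X ⟶ Y) (g : X' ⟶ Y') :
    graph f ⊗ₘ graph g = graph (f ⊗ₘ g) := by
  refine ext_mem fun U (a : U ⟶ X ⊗ X') (b : U ⟶ Y ⊗ Y') => ?_
  refine mem_tensorHom.trans (Iff.trans ?_ mem_graph.symm)
  refine (and_congr mem_graph mem_graph).trans ⟨fun h => ?_, fun h => ?_⟩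
  · refine CartesianMonoidalCategory.hom_ext _ _ ?_ ?_
    · simpa using h.1
    · simpa using h.2
  · subst h
    constructor <;> simp

theorem mem_graph_iso_comp {X Y : C} {Z : Rel C} (e : X ≅ Y) {y : Rel.mk Y ⟶ Z} {U : C}
    {a : U ⟶ X} {c : U ⟶ Z.as} : Mem ((graphIso e).hom ≫ y) a c ↔ Mem y (a ≫ e.hom) c :=
  mem_graph_comp

theorem mem_comp_graph_iso {X Y : C} {W : Rel C} (e : X ≅ Y) {x : W ⟶ Rel.mk X} {U : C}
    {a : U ⟶ W.as} {c : U ⟶ Y} : Mem (x ≫ (graphIso e).hom) a c ↔ Mem x a (c ≫ e.inv) := by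
  rw [graphIso_hom, graph_iso_hom, mem_comp_cograph]

theorem id_tensorHom_id (X Y : Rel C) : 𝟙 X ⊗ₘ 𝟙 Y = 𝟙 (X ⊗ Y) := by
  refine (graph_tensorHom (𝟙 X.as) (𝟙 Y.as)).trans ?_
  rw [MonoidalCategory.id_tensorHom_id]
  rfl

theorem tensorHom_comp_tensorHom {X₁ Y₁ Z₁ X₂ Y₂ Z₂ : Rel C} (f₁ : X₁ ⟶ Y₁) (f₂ : X₂ ⟶ Y₂)
    (g₁ : Y₁ ⟶ Z₁) (g₂ : Y₂ ⟶ Z₂) : (f₁ ⊗ₘ f₂) ≫ (g₁ ⊗ₘ g₂) = (f₁ ≫ g₁) ⊗ₘ (f₂ ≫ g₂) := by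
  refine ext_mem fun U (a : U ⟶ X₁.as ⊗ X₂.as) (c : U ⟶ Z₁.as ⊗ Z₂.as) => ?_
  rw [mem_comp, mem_tensorHom]
  constructor
  · rintro ⟨U', e, b, he, hf, hg⟩
    obtain ⟨hf₁, hf₂⟩ := mem_tensorHom.1 hf
    obtain ⟨hg₁, hg₂⟩ := mem_tensorHom.1 hg
    rw [Category.assoc] at hf₁ hf₂ hg₁ hg₂
    exact ⟨mem_comp.2 ⟨U', e, _, he, hf₁, hg₁⟩, mem_comp.2 ⟨U', e, _, he, hf₂, hg₂⟩⟩
  · rintro ⟨h₁, h₂⟩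
    obtain ⟨U₁, e₁, b₁, he₁, hf₁, hg₁⟩ := mem_comp.1 h₁
    obtain ⟨U₂, e₂, b₂, he₂, hf₂, hg₂⟩ := mem_comp.1 h₂
    obtain ⟨V, p, q, hp, hpq⟩ := exists_cover_pullback e₁ e₂
    refine ⟨V, p ≫ e₂, lift (q ≫ b₁) (p ≫ b₂), strongEpi_comp _ _, mem_tensorHom.2 ?_,
      mem_tensorHom.2 ?_⟩
    · constructor
      · have := hf₁.precomp q
        rw [← Category.assoc, hpq] at this
        simpa using this
      · simpa using hf₂.precomp p
    · constructor
      · have := hg₁.precomp q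
        rw [← Category.assoc q, hpq] at this
        simpa using this
      · simpa using hg₂.precomp p

theorem associator_naturality {X₁ X₂ X₃ Y₁ Y₂ Y₃ : Rel C} (f₁ : X₁ ⟶ Y₁) (f₂ : X₂ ⟶ Y₂)
    (f₃ : X₃ ⟶ Y₃) : ((f₁ ⊗ₘ f₂) ⊗ₘ f₃) ≫ (α_ Y₁ Y₂ Y₃).hom =
      (α_ X₁ X₂ X₃).hom ≫ (f₁ ⊗ₘ (f₂ ⊗ₘ f₃)) := by
  refine ext_mem fun U a c => ?_
  refine (mem_comp_graph_iso _).trans (Iff.trans ?_ (mem_graph_iso_comp _).symm)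
  refine mem_tensorHom.trans (Iff.trans (and_congr_left' mem_tensorHom)
    (Iff.trans ?_ (mem_tensorHom.trans (and_congr_right' mem_tensorHom)).symm))
  simp [and_assoc]

theorem leftUnitor_naturality {X Y : Rel C} (f : X ⟶ Y) :
    (𝟙 (𝟙_ (Rel C)) ⊗ₘ f) ≫ (λ_ Y).hom = (λ_ X).hom ≫ f := by
  refine ext_mem fun U a c => ?_
  refine (mem_comp_graph_iso _).trans (Iff.trans ?_ (mem_graph_iso_comp _).symm)
  refine mem_tensorHom.trans ?_
  have : Mem (𝟙 (𝟙_ (Rel C))) (a ≫ fst (𝟙_ C) X.as) ((c ≫ (λ_ Y.as).inv) ≫ fst (𝟙_ C) Y.as) :=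
    mem_id.2 (toUnit_unique _ _)
  refine (and_iff_right this).trans ?_
  change Mem f (a ≫ snd (𝟙_ C) X.as) ((c ≫ (λ_ Y.as).inv) ≫ snd (𝟙_ C) Y.as) ↔
    Mem f (a ≫ (λ_ X.as).hom) c
  rw [leftUnitor_hom, Category.assoc, leftUnitor_inv_snd, Category.comp_id]

theorem rightUnitor_naturality {X Y : Rel C} (f : X ⟶ Y) :
    (f ⊗ₘ 𝟙 (𝟙_ (Rel C))) ≫ (ρ_ Y).hom = (ρ_ X).hom ≫ f := by
  refine ext_mem fun U a c => ?_
  refine (mem_comp_graph_iso _).trans (Iff.trans ?_ (mem_graph_iso_comp _).symm)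
  refine mem_tensorHom.trans ?_
  have : Mem (𝟙 (𝟙_ (Rel C))) (a ≫ snd X.as (𝟙_ C)) ((c ≫ (ρ_ Y.as).inv) ≫ snd Y.as (𝟙_ C)) :=
    mem_id.2 (toUnit_unique _ _)
  refine (and_iff_left this).trans ?_
  change Mem f (a ≫ fst X.as (𝟙_ C)) ((c ≫ (ρ_ Y.as).inv) ≫ fst Y.as (𝟙_ C)) ↔
    Mem f (a ≫ (ρ_ X.as).hom) c
  rw [rightUnitor_hom, Category.assoc, rightUnitor_inv_fst, Category.comp_id]

theorem pentagon (W X Y Z : Rel C) :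
    ((α_ W X Y).hom ⊗ₘ 𝟙 Z) ≫ (α_ W (X ⊗ Y) Z).hom ≫ (𝟙 W ⊗ₘ (α_ X Y Z).hom) =
      (α_ (W ⊗ X) Y Z).hom ≫ (α_ W X (Y ⊗ Z)).hom := by
  change (graph (α_ W.as X.as Y.as).hom ⊗ₘ graph (𝟙 Z.as)) ≫
    graph (α_ W.as (X.as ⊗ Y.as) Z.as).hom ≫ (graph (𝟙 W.as) ⊗ₘ graph (α_ X.as Y.as Z.as).hom) =
      graph (α_ (W.as ⊗ X.as) Y.as Z.as).hom ≫ graph (α_ W.as X.as (Y.as ⊗ Z.as)).hom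
  rw [graph_tensorHom, graph_tensorHom]
  exact (congrArg _ (graph_comp _ _).symm).trans ((graph_comp _ _).symm.trans
    ((congrArg graph (by simp)).trans (graph_comp _ _)))

theorem triangle (X Y : Rel C) :
    (α_ X (𝟙_ (Rel C)) Y).hom ≫ (𝟙 X ⊗ₘ (λ_ Y).hom) = (ρ_ X).hom ⊗ₘ 𝟙 Y := by
  change graph (α_ X.as (𝟙_ C) Y.as).hom ≫ (graph (𝟙 X.as) ⊗ₘ graph (λ_ Y.as).hom) =
    graph (ρ_ X.as).hom ⊗ₘ graph (𝟙 Y.as)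
  rw [graph_tensorHom, graph_tensorHom]
  exact (graph_comp _ _).symm.trans (congrArg graph (by simp))

noncomputable instance : MonoidalCategory (Rel C) :=
  .ofTensorHom
    (id_tensorHom_id := id_tensorHom_id)
    (id_tensorHom := fun _ _ _ _ => rfl)
    (tensorHom_id := fun _ _ => rfl)
    (tensorHom_comp_tensorHom := tensorHom_comp_tensorHom)
    (associator_naturality := associator_naturality)
    (leftUnitor_naturality := leftUnitor_naturality)
    (rightUnitor_naturality := rightUnitor_naturality)
    (pentagon := pentagon)
    (triangle := triangle)

/-- The symmetry of the product of `C`. -/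
@[simps]
def swapIso (X Y : C) : X ⊗ Y ≅ Y ⊗ X where
  hom := lift (snd X Y) (fst X Y)
  inv := lift (snd Y X) (fst Y X)

theorem graph_whiskerRight {X Y : C} (f : X ⟶ Y) (Z : Rel C) :
    graph f ▷ Z = graph (f ▷ Z.as) := by
  refine (graph_tensorHom f (𝟙 Z.as)).trans ?_
  rw [MonoidalCategory.tensorHom_id]

theorem graph_whiskerLeft {X Y : C} (f : X ⟶ Y) (Z : Rel C) :
    Z ◁ graph f = graph (Z.as ◁ f) := by
  refine (graph_tensorHom (𝟙 Z.as) f).trans ?_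
  rw [MonoidalCategory.id_tensorHom]

theorem braiding_naturality {X Y X' Y' : Rel C} (f : X ⟶ Y) (g : X' ⟶ Y') :
    (f ⊗ₘ g) ≫ (graphIso (swapIso Y.as Y'.as)).hom =
      (graphIso (swapIso X.as X'.as)).hom ≫ (g ⊗ₘ f) := by
  refine ext_mem fun U a c => ?_
  refine (mem_comp_graph_iso _).trans (Iff.trans ?_ (mem_graph_iso_comp _).symm)
  refine mem_tensorHom.trans (Iff.trans ?_ mem_tensorHom.symm)
  simp [and_comm]

noncomputable instance : BraidedCategory (Rel C) where
  braiding X Y := graphIso (swapIso X.as Y.as)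
  braiding_naturality_right X Y Z f :=
    (congrArg (· ≫ _) (MonoidalCategory.id_tensorHom X f)).symm.trans
      ((braiding_naturality (𝟙 X) f).trans
        (congrArg (_ ≫ ·) (MonoidalCategory.tensorHom_id f X)))
  braiding_naturality_left f Z :=
    (congrArg (· ≫ _) (MonoidalCategory.tensorHom_id f Z)).symm.trans
      ((braiding_naturality f (𝟙 Z)).trans
        (congrArg (_ ≫ ·) (MonoidalCategory.id_tensorHom Z f)))
  hexagon_forward X Y Z := by
    refine ((graph_comp _ _).trans (congrArg (_ ≫ ·) (graph_comp _ _))).symm.trans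
      (Eq.trans (congrArg graph ?_) ((graph_comp _ _).trans
        (congrArg₂ _ (graph_whiskerRight _ _).symm
          ((graph_comp _ _).trans (congrArg (_ ≫ ·) (graph_whiskerLeft _ _).symm)))))
    ext <;> simp
  hexagon_reverse X Y Z := by
    refine ((graph_comp _ _).trans (congrArg (_ ≫ ·) (graph_comp _ _))).symm.trans
      (Eq.trans (congrArg graph ?_) ((graph_comp _ _).trans
        (congrArg₂ _ (graph_whiskerLeft _ _).symm
          ((graph_comp _ _).trans (congrArg (_ ≫ ·) (graph_whiskerRight _ _).symm)))))
    ext <;> simp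

noncomputable instance : SymmetricCategory (Rel C) where
  symmetry X Y := by
    refine (graph_comp _ _).symm.trans (congrArg graph ?_)
    ext <;> simp

end Rel

/-! ### Ajax functors and the internal relations of a regular calculus -/

/-- A lax symmetric monoidal functor `F` between symmetric monoidal po-categories is ajax
(adjoint-lax) if it is a po-functor and its laxators are right adjoints. -/
class IsAjax {C : Type u₁} [PoCategory.{v₁} C] [MonoidalCategory C] [BraidedCategory C]
    {D : Type u₂} [PoCategory.{v₂} D] [MonoidalCategory D] [BraidedCategory D]
    (F : C ⥤ D) [F.LaxBraided] : Prop where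
  map_mono : IsPoFunctor F
  unit : ∃ L : F.obj (𝟙_ C) ⟶ 𝟙_ D, Adj L (Functor.LaxMonoidal.ε F)
  tensor : ∀ X Y : C, ∃ L : F.obj (X ⊗ Y) ⟶ F.obj X ⊗ F.obj Y, Adj L (Functor.LaxMonoidal.μ F X Y)

namespace Rel

section

variable {C : Type u} [Category.{v} C] [CartesianMonoidalCategory C]

theorem exists_lift {X Y U : C} (a : U ⟶ X ⊗ Y) : ∃ (b : U ⟶ X) (c : U ⟶ Y), a = lift b c :=
  ⟨a ≫ fst _ _, a ≫ snd _ _, by ext <;> simp⟩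

theorem lift_inj {X Y U : C} {a a' : U ⟶ X} {b b' : U ⟶ Y} :
    lift a b = lift a' b' ↔ a = a' ∧ b = b' := by
  refine ⟨fun h => ?_, by rintro ⟨rfl, rfl⟩; rfl⟩
  have h₁ := congrArg (· ≫ fst _ _) h
  have h₂ := congrArg (· ≫ snd _ _) h
  simpa using And.intro h₁ h₂

end

variable {C : Type u} [Category.{v} C] [CartesianMonoidalCategory C] [Regular C]

/-- The pairs `((a, b), (b, c))`, where `(a, b, c)` is a generalized element of `X × Y × Z`. -/
def glue (X Y Z : C) : X ⊗ Y ⊗ Z ⟶ (X ⊗ Y) ⊗ (Y ⊗ Z) :=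
  lift (lift (fst _ _) (snd _ _ ≫ fst _ _)) (snd _ _)

/-- The projection of `X × Y × Z` onto `X × Z`. -/
def outer (X Y Z : C) : X ⊗ Y ⊗ Z ⟶ X ⊗ Z :=
  lift (fst _ _) (snd _ _ ≫ snd _ _)

/-- The relation from `(X × Y) × (Y × Z)` to `X × Z` which relates `((a, b), (b, c))` to `(a, c)`: the
wiring diagram for the composition of relations. -/
noncomputable def wire (X Y Z : C) : Rel.mk ((X ⊗ Y) ⊗ (Y ⊗ Z)) ⟶ Rel.mk (X ⊗ Z) :=
  cograph (glue X Y Z) ≫ graph (outer X Y Z)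

theorem mem_comp_graph {X Y U : C} {W : Rel C} {f : X ⟶ Y} {x : W ⟶ Rel.mk X} {a : U ⟶ W.as}
    {c : U ⟶ Y} : Mem (x ≫ graph f) a c ↔ ∃ (U' : C) (e : U' ⟶ U) (b : U' ⟶ X), StrongEpi e ∧
      Mem x (e ≫ a) b ∧ b ≫ f = e ≫ c := by
  rw [mem_comp]
  simp only [mem_graph]

theorem mem_wire {X Y Z U : C} {a : U ⟶ (X ⊗ Y) ⊗ (Y ⊗ Z)} {c : U ⟶ X ⊗ Z} :
    Mem (wire X Y Z) a c ↔ a ≫ fst _ _ ≫ snd _ _ = a ≫ snd _ _ ≫ fst _ _ ∧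
      a ≫ fst _ _ ≫ fst _ _ = c ≫ fst _ _ ∧ a ≫ snd _ _ ≫ snd _ _ = c ≫ snd _ _ := by
  rw [wire, mem_comp_graph]
  simp only [mem_cograph]
  constructor
  · rintro ⟨U', e, b, he, h, h'⟩
    have h₁ := congrArg (· ≫ fst _ _ ≫ fst _ _) h
    have h₂ := congrArg (· ≫ fst _ _ ≫ snd _ _) h
    have h₃ := congrArg (· ≫ snd _ _ ≫ fst _ _) h
    have h₄ := congrArg (· ≫ snd _ _ ≫ snd _ _) h
    have h₅ := congrArg (· ≫ fst _ _) h'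
    have h₆ := congrArg (· ≫ snd _ _) h'
    simp only [glue, outer, Category.assoc, lift_fst, lift_snd, lift_fst_assoc,
      lift_snd_assoc] at h₁ h₂ h₃ h₄ h₅ h₆
    refine ⟨?_, ?_, ?_⟩ <;> rw [← cancel_epi e]
    · rw [← h₂, ← h₃]
    · rw [← h₁, ← h₅]
    · rw [← h₄, ← h₆]
  · rintro ⟨h₁, h₂, h₃⟩
    refine ⟨U, 𝟙 U, lift (a ≫ fst _ _ ≫ fst _ _) (a ≫ snd _ _), inferInstance, ?_, ?_⟩
    · rw [Category.id_comp]
      ext <;> simp [glue, h₁]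
    · rw [Category.id_comp]
      ext <;> simp [outer, h₂, h₃]

theorem mem_wire' {X Y Z U : C} {a : U ⟶ X} {b b' : U ⟶ Y} {c : U ⟶ Z} {a' : U ⟶ X} {c' : U ⟶ Z} :
    Mem (wire X Y Z) (lift (lift a b) (lift b' c)) (lift a' c') ↔ b = b' ∧ a = a' ∧ c = c' := by
  rw [mem_wire]
  simp

theorem mem_tensorHom' {X Y X' Y' : Rel C} {x : X ⟶ Y} {y : X' ⟶ Y'} {U : C}
    {a : U ⟶ X.as} {a' : U ⟶ X'.as} {b : U ⟶ Y.as} {b' : U ⟶ Y'.as} :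
    Mem (x ⊗ₘ y) (lift a a') (lift b b') ↔ Mem x a b ∧ Mem y a' b' := by
  refine mem_tensorHom.trans ?_
  simp

theorem wire_assoc_left {W X Y Z U : C} {a a' : U ⟶ W} {b b' : U ⟶ X} {c c' : U ⟶ Y}
    {d d' : U ⟶ Z} :
    Mem ((wire W X Y ⊗ₘ 𝟙 (Rel.mk (Y ⊗ Z))) ≫ wire W Y Z)
      (lift (lift (lift a b) (lift b' c)) (lift c' d)) (lift a' d') ↔
        (b = b' ∧ c = c') ∧ a = a' ∧ d = d' := by
  rw [mem_comp]
  constructor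
  · rintro ⟨U', e, t, he, h, h'⟩
    obtain ⟨t₁, t₂, rfl⟩ := exists_lift t
    obtain ⟨p, q, rfl⟩ := exists_lift t₁
    obtain ⟨r, s, rfl⟩ := exists_lift t₂
    rw [comp_lift] at h h'
    obtain ⟨h₁, h₂⟩ := mem_tensorHom'.1 h
    have h₂ := mem_id.1 h₂
    rw [comp_lift, comp_lift, comp_lift, mem_wire'] at h₁
    rw [comp_lift, lift_inj] at h₂
    rw [mem_wire'] at h'
    obtain ⟨h₁, rfl, rfl⟩ := h₁
    obtain ⟨rfl, rfl⟩ := h₂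
    rw [cancel_epi] at h₁
    rw [cancel_epi, cancel_epi, cancel_epi] at h'
    exact ⟨⟨h₁, h'.1⟩, h'.2⟩
  · rintro ⟨⟨rfl, rfl⟩, rfl, rfl⟩
    refine ⟨U, 𝟙 U, lift (lift a c) (lift c d), inferInstance, ?_, ?_⟩
    · rw [Category.id_comp]
      exact mem_tensorHom'.2 ⟨mem_wire'.2 ⟨rfl, rfl, rfl⟩, mem_id.2 rfl⟩
    · rw [Category.id_comp]
      exact mem_wire'.2 ⟨rfl, rfl, rfl⟩

theorem wire_assoc_right {W X Y Z U : C} {a a' : U ⟶ W} {b b' : U ⟶ X} {c c' : U ⟶ Y}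
    {d d' : U ⟶ Z} :
    Mem ((𝟙 (Rel.mk (W ⊗ X)) ⊗ₘ wire X Y Z) ≫ wire W X Z)
      (lift (lift a b) (lift (lift b' c) (lift c' d))) (lift a' d') ↔
        (b = b' ∧ c = c') ∧ a = a' ∧ d = d' := by
  rw [mem_comp]
  constructor
  · rintro ⟨U', e, t, he, h, h'⟩
    obtain ⟨t₁, t₂, rfl⟩ := exists_lift t
    obtain ⟨p, q, rfl⟩ := exists_lift t₁
    obtain ⟨r, s, rfl⟩ := exists_lift t₂
    rw [comp_lift] at h h'
    obtain ⟨h₂, h₁⟩ := mem_tensorHom'.1 h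
    have h₂ := mem_id.1 h₂
    rw [comp_lift, comp_lift, comp_lift, mem_wire'] at h₁
    rw [comp_lift, lift_inj] at h₂
    rw [mem_wire'] at h'
    obtain ⟨h₁, rfl, rfl⟩ := h₁
    obtain ⟨rfl, rfl⟩ := h₂
    rw [cancel_epi] at h₁
    rw [cancel_epi, cancel_epi, cancel_epi] at h'
    exact ⟨⟨h'.1, h₁⟩, h'.2⟩
  · rintro ⟨⟨rfl, rfl⟩, rfl, rfl⟩
    refine ⟨U, 𝟙 U, lift (lift a b) (lift b d), inferInstance, ?_, ?_⟩
    · rw [Category.id_comp]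
      exact mem_tensorHom'.2 ⟨mem_id.2 rfl, mem_wire'.2 ⟨rfl, rfl, rfl⟩⟩
    · rw [Category.id_comp]
      exact mem_wire'.2 ⟨rfl, rfl, rfl⟩

theorem wire_assoc (W X Y Z : C) :
    (wire W X Y ⊗ₘ 𝟙 (Rel.mk (Y ⊗ Z))) ≫ wire W Y Z =
      (α_ (Rel.mk (W ⊗ X)) (Rel.mk (X ⊗ Y)) (Rel.mk (Y ⊗ Z))).hom ≫
        (𝟙 (Rel.mk (W ⊗ X)) ⊗ₘ wire X Y Z) ≫ wire W X Z := by
  refine ext_mem fun U (a : U ⟶ ((W ⊗ X) ⊗ (X ⊗ Y)) ⊗ (Y ⊗ Z)) (c : U ⟶ W ⊗ Z) => ?_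
  refine Iff.trans ?_ (mem_graph_iso_comp _).symm
  obtain ⟨a, a₃, rfl⟩ := exists_lift a
  obtain ⟨a₁, a₂, rfl⟩ := exists_lift a
  obtain ⟨p₁, p₂, rfl⟩ := exists_lift a₁
  obtain ⟨p₃, p₄, rfl⟩ := exists_lift a₂
  obtain ⟨p₅, p₆, rfl⟩ := exists_lift a₃
  obtain ⟨q₁, q₂, rfl⟩ := exists_lift c
  rw [lift_lift_associator_hom]
  exact wire_assoc_left.trans wire_assoc_right.symm

/-- The diagonal. -/
abbrev diag (X : C) : X ⟶ X ⊗ X := lift (𝟙 X) (𝟙 X)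

theorem mem_diag_wire {X Y U : C} {a a' c : U ⟶ X} {b d : U ⟶ Y} :
    Mem ((graph (diag X) ⊗ₘ 𝟙 (Rel.mk (X ⊗ Y))) ≫ wire X X Y) (lift a (lift a' b)) (lift c d) ↔
      a = a' ∧ a = c ∧ b = d := by
  rw [← graph_id, graph_tensorHom, mem_graph_comp, lift_map, comp_lift, Category.comp_id,
    Category.comp_id]
  exact mem_wire'

theorem mem_wire_diag {X Y U : C} {a c : U ⟶ X} {b b' d : U ⟶ Y} :
    Mem ((𝟙 (Rel.mk (X ⊗ Y)) ⊗ₘ graph (diag Y)) ≫ wire X Y Y) (lift (lift a b) b') (lift c d) ↔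
      b = b' ∧ a = c ∧ b' = d := by
  rw [← graph_id, graph_tensorHom, mem_graph_comp, lift_map, comp_lift, Category.comp_id,
    Category.comp_id]
  exact mem_wire'

theorem wire_fst_le (X Y Z : C) :
    wire X Y Z ≫ graph (fst X Z) ≤ graph (fst (X ⊗ Y) (Y ⊗ Z)) ≫ graph (fst X Y) := by
  refine le_iff.2 fun U a c h => ?_
  obtain ⟨U', e, b, he, h, h'⟩ := mem_comp_graph.1 h
  refine mem_graph_comp.2 (mem_graph.2 ?_)
  have := (mem_wire.1 h).2.1
  rw [h', Category.assoc, cancel_epi] at this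
  simpa using this

theorem wire_snd_le (X Y Z : C) :
    wire X Y Z ≫ graph (snd X Z) ≤ graph (snd (X ⊗ Y) (Y ⊗ Z)) ≫ graph (snd Y Z) := by
  refine le_iff.2 fun U a c h => ?_
  obtain ⟨U', e, b, he, h, h'⟩ := mem_comp_graph.1 h
  refine mem_graph_comp.2 (mem_graph.2 ?_)
  have := (mem_wire.1 h).2.2
  rw [h', Category.assoc, cancel_epi] at this
  simpa using this

theorem diag_wire_le (X Y : C) :
    (graph (diag X) ⊗ₘ 𝟙 (Rel.mk (X ⊗ Y))) ≫ wire X X Y ≤ graph (snd X (X ⊗ Y)) := by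
  refine le_iff.2 fun U (a : U ⟶ X ⊗ X ⊗ Y) (c : U ⟶ X ⊗ Y) h => ?_
  obtain ⟨a₁, a₂, rfl⟩ := exists_lift a
  obtain ⟨p, q, rfl⟩ := exists_lift a₂
  obtain ⟨r, s, rfl⟩ := exists_lift c
  obtain ⟨rfl, rfl, rfl⟩ := mem_diag_wire.1 h
  exact mem_graph.2 (lift_snd _ _)

theorem wire_diag_le (X Y : C) :
    (𝟙 (Rel.mk (X ⊗ Y)) ⊗ₘ graph (diag Y)) ≫ wire X Y Y ≤ graph (fst (X ⊗ Y) Y) := by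
  refine le_iff.2 fun U (a : U ⟶ (X ⊗ Y) ⊗ Y) (c : U ⟶ X ⊗ Y) h => ?_
  obtain ⟨a₁, a₂, rfl⟩ := exists_lift a
  obtain ⟨p, q, rfl⟩ := exists_lift a₁
  obtain ⟨r, s, rfl⟩ := exists_lift c
  obtain ⟨rfl, rfl, rfl⟩ := mem_wire_diag.1 h
  exact mem_graph.2 (lift_fst _ _)

theorem cograph_diag_le_left (X Y : C) :
    cograph (diag (X ⊗ Y)) ≤ (graph (fst X Y) ⊗ₘ 𝟙 (Rel.mk (X ⊗ Y))) ≫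
      (graph (diag X) ⊗ₘ 𝟙 (Rel.mk (X ⊗ Y))) ≫ wire X X Y := by
  refine le_iff.2 fun U (a : U ⟶ (X ⊗ Y) ⊗ (X ⊗ Y)) (c : U ⟶ X ⊗ Y) h => ?_
  obtain ⟨p, q, rfl⟩ := exists_lift c
  obtain rfl := mem_cograph.1 h
  rw [← graph_id (X ⊗ Y), graph_tensorHom, mem_graph_comp, comp_lift, Category.comp_id, lift_map,
    Category.comp_id, lift_fst]
  exact mem_diag_wire.2 ⟨rfl, rfl, rfl⟩

theorem cograph_diag_le_right (X Y : C) :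
    cograph (diag (X ⊗ Y)) ≤ (𝟙 (Rel.mk (X ⊗ Y)) ⊗ₘ graph (snd X Y)) ≫
      (𝟙 (Rel.mk (X ⊗ Y)) ⊗ₘ graph (diag Y)) ≫ wire X Y Y := by
  refine le_iff.2 fun U (a : U ⟶ (X ⊗ Y) ⊗ (X ⊗ Y)) (c : U ⟶ X ⊗ Y) h => ?_
  obtain ⟨p, q, rfl⟩ := exists_lift c
  obtain rfl := mem_cograph.1 h
  rw [← graph_id (X ⊗ Y), graph_tensorHom, mem_graph_comp, comp_lift, Category.comp_id, lift_map,
    Category.comp_id, lift_snd]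
  exact mem_wire_diag.2 ⟨rfl, rfl, rfl⟩

theorem le_graph_cograph {X Y : C} (f : X ⟶ Y) : 𝟙 (Rel.mk X) ≤ graph f ≫ cograph f := by
  refine le_iff.2 fun U (a : U ⟶ X) (c : U ⟶ X) h => ?_
  obtain rfl := mem_id.1 h
  exact mem_graph_comp.2 (mem_cograph.2 rfl)

theorem diag_le_left (X : C) : graph (diag X) ≤
    (λ_ (Rel.mk X)).inv ≫ (cograph (toUnit X) ⊗ₘ 𝟙 (Rel.mk X)) := by
  refine le_iff.2 fun U (a : U ⟶ X) (c : U ⟶ X ⊗ X) h => ?_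
  obtain rfl := mem_graph.1 h
  refine mem_graph_comp.2 (mem_tensorHom.2 ⟨mem_cograph.2 (toUnit_unique _ _), mem_id.2 ?_⟩)
  simp
  change a ≫ (λ_ X).inv ≫ snd (𝟙_ C) X = a
  simp

theorem diag_le_right (X : C) : graph (diag X) ≤
    (ρ_ (Rel.mk X)).inv ≫ (𝟙 (Rel.mk X) ⊗ₘ cograph (toUnit X)) := by
  refine le_iff.2 fun U (a : U ⟶ X) (c : U ⟶ X ⊗ X) h => ?_
  obtain rfl := mem_graph.1 h
  refine mem_graph_comp.2 (mem_tensorHom.2 ⟨mem_id.2 ?_, mem_cograph.2 (toUnit_unique _ _)⟩)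
  simp
  change a ≫ (ρ_ X).inv ≫ fst X (𝟙_ C) = a
  simp

theorem fst_eq (X Y : C) : graph (fst X Y) =
    (𝟙 (Rel.mk X) ⊗ₘ graph (toUnit Y)) ≫ (ρ_ (Rel.mk X)).hom := by
  change _ = (graph (𝟙 X) ⊗ₘ graph (toUnit Y)) ≫ graph (ρ_ X).hom
  rw [graph_tensorHom]
  exact (congrArg graph (by rw [rightUnitor_hom]; simp)).trans (graph_comp _ _)

theorem snd_eq (X Y : C) : graph (snd X Y) =
    (graph (toUnit X) ⊗ₘ 𝟙 (Rel.mk Y)) ≫ (λ_ (Rel.mk Y)).hom := by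
  change _ = (graph (toUnit X) ⊗ₘ graph (𝟙 Y)) ≫ graph (λ_ Y).hom
  rw [graph_tensorHom]
  exact (congrArg graph (by rw [leftUnitor_hom]; simp)).trans (graph_comp _ _)

end Rel

section

variable {C : Type u} [Category.{v} C] [CartesianMonoidalCategory C] [Regular C]
variable (P : Rel C ⥤ PartOrd.{w})

/-- The action of a relation on predicates. -/
def act {X Y : Rel C} (r : X ⟶ Y) (φ : P.obj X) : P.obj Y := (P.map r).hom φ

theorem act_mono {X Y : Rel C} (r : X ⟶ Y) {φ ψ : P.obj X} (h : φ ≤ ψ) : act P r φ ≤ act P r ψ :=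
  (P.map r).hom.monotone h

theorem act_id {X : Rel C} (φ : P.obj X) : act P (𝟙 X) φ = φ := by simp [act]

theorem act_comp {X Y Z : Rel C} (r : X ⟶ Y) (s : Y ⟶ Z) (φ : P.obj X) :
    act P (r ≫ s) φ = act P s (act P r φ) := by simp [act]

variable [P.LaxBraided]

/-- The laxator `P(X) × P(Y) → P(X ⊗ Y)`. -/
noncomputable def lax {X Y : Rel C} (φ : P.obj X) (ψ : P.obj Y) : P.obj (X ⊗ Y) :=
  (Functor.LaxMonoidal.μ P X Y).hom ((φ, ψ) : P.obj X × P.obj Y)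

/-- The unit laxator `1 → P(𝟙_)`, as an element. -/
noncomputable def laxUnit : P.obj (𝟙_ (Rel C)) :=
  (Functor.LaxMonoidal.ε P).hom PUnit.unit

theorem lax_mono {X Y : Rel C} {φ φ' : P.obj X} {ψ ψ' : P.obj Y} (h : φ ≤ φ') (h' : ψ ≤ ψ') :
    lax P φ ψ ≤ lax P φ' ψ' :=
  (Functor.LaxMonoidal.μ P X Y).hom.monotone (Prod.mk_le_mk.2 ⟨h, h'⟩)

theorem act_lax {X Y X' Y' : Rel C} (r : X ⟶ Y) (r' : X' ⟶ Y') (φ : P.obj X) (φ' : P.obj X') :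
    act P (r ⊗ₘ r') (lax P φ φ') = lax P (act P r φ) (act P r' φ') :=
  (ConcreteCategory.congr_hom (Functor.LaxMonoidal.μ_natural P r r')
    ((φ, φ') : P.obj X × P.obj X')).symm

theorem act_assoc {X Y Z : Rel C} (φ : P.obj X) (ψ : P.obj Y) (χ : P.obj Z) :
    act P (α_ X Y Z).hom (lax P (lax P φ ψ) χ) = lax P φ (lax P ψ χ) :=
  ConcreteCategory.congr_hom (Functor.LaxMonoidal.associativity P X Y Z)
    (((φ, ψ), χ) : (P.obj X × P.obj Y) × P.obj Z)

theorem act_left {X : Rel C} (φ : P.obj X) : act P (λ_ X).hom (lax P (laxUnit P) φ) = φ :=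
  (ConcreteCategory.congr_hom (Functor.LaxMonoidal.left_unitality P X)
    ((PUnit.unit, φ) : PUnit × P.obj X)).symm

theorem act_right {X : Rel C} (φ : P.obj X) : act P (ρ_ X).hom (lax P φ (laxUnit P)) = φ :=
  (ConcreteCategory.congr_hom (Functor.LaxMonoidal.right_unitality P X)
    ((φ, PUnit.unit) : P.obj X × PUnit)).symm

variable [IsAjax P]

theorem act_le_act {X Y : Rel C} {r s : X ⟶ Y} (h : r ≤ s) (φ : P.obj X) :
    act P r φ ≤ act P s φ := IsAjax.map_mono (F := P) h φ

theorem le_laxUnit (φ : P.obj (𝟙_ (Rel C))) : φ ≤ laxUnit P := by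
  obtain ⟨L, h, -⟩ := IsAjax.unit (F := P)
  exact h φ

theorem exists_split {X Y : Rel C} (φ : P.obj (X ⊗ Y)) : ∃ (a : P.obj X) (b : P.obj Y),
    φ ≤ lax P a b ∧ ∀ a' b', φ ≤ lax P a' b' → a ≤ a' ∧ b ≤ b' := by
  obtain ⟨L, h, h'⟩ := IsAjax.tensor (F := P) X Y
  let p : P.obj X × P.obj Y := L.hom φ
  refine ⟨p.1, p.2, h φ, fun a b hab => ?_⟩
  have h₁ : p ≤ (a, b) := le_trans (L.hom.monotone hab) (h' ((a, b) : P.obj X × P.obj Y))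
  exact h₁

theorem act_fst_le {X Y : C} (φ : P.obj ⟨X⟩) (ψ : P.obj ⟨Y⟩) :
    act P (Rel.graph (fst X Y)) (lax P φ ψ) ≤ φ := by
  rw [Rel.fst_eq, act_comp, act_lax, act_id]
  exact (act_mono P _ (lax_mono P le_rfl (le_laxUnit P _))).trans (act_right P φ).le

theorem act_snd_le {X Y : C} (φ : P.obj ⟨X⟩) (ψ : P.obj ⟨Y⟩) :
    act P (Rel.graph (snd X Y)) (lax P φ ψ) ≤ ψ := by
  rw [Rel.snd_eq, act_comp, act_lax, act_id]
  exact (act_mono P _ (lax_mono P (le_laxUnit P _) le_rfl)).trans (act_left P ψ).le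

theorem le_act_diag {X : C} (φ : P.obj ⟨X⟩) :
    φ ≤ act P (Rel.cograph (Rel.diag X)) (lax P φ φ) := by
  obtain ⟨a, b, h, h'⟩ := exists_split P (X := ⟨X⟩) (Y := ⟨X⟩) (act P (Rel.graph (Rel.diag X)) φ)
  have ha : a ≤ φ := by
    refine (h' φ (act P (Rel.cograph (toUnit X)) (laxUnit P))
      ((act_le_act P (Rel.diag_le_right X) φ).trans (le_of_eq ?_))).1
    conv_lhs => rw [← act_right P φ, ← act_comp, Iso.hom_inv_id_assoc, act_lax, act_id]
  have hb : b ≤ φ := by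
    refine (h' (act P (Rel.cograph (toUnit X)) (laxUnit P)) φ
      ((act_le_act P (Rel.diag_le_left X) φ).trans (le_of_eq ?_))).2
    conv_lhs => rw [← act_left P φ, ← act_comp, Iso.hom_inv_id_assoc, act_lax, act_id]
  calc φ = act P (𝟙 _) φ := (act_id P φ).symm
    _ ≤ _ := act_le_act P (Rel.le_graph_cograph (Rel.diag X)) φ
    _ = _ := act_comp P _ _ _
    _ ≤ _ := act_mono P _ (h.trans (lax_mono P ha hb))

end

/-- The objects of the po-category of internal relations: a context with a predicate on it. -/
structure IntRel {C : Type u} [Category.{v} C] [CartesianMonoidalCategory C] [Regular C]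
    (P : Rel C ⥤ PartOrd.{w}) where
  ctx : C
  pred : P.obj ⟨ctx⟩

namespace IntRel

variable {C : Type u} [Category.{v} C] [CartesianMonoidalCategory C] [Regular C]
variable {P : Rel C ⥤ PartOrd.{w}}

/-- An internal relation from `(Γ₁, φ₁)` to `(Γ₂, φ₂)`: a predicate `θ` on `Γ₁ ⊗ Γ₂` whose
direct images under the projections entail `φ₁` and `φ₂`. -/
def Hom (X Y : IntRel P) : Type w :=
  {θ : P.obj ⟨X.ctx ⊗ Y.ctx⟩ // act P (Rel.graph (fst X.ctx Y.ctx)) θ ≤ X.pred ∧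
    act P (Rel.graph (snd X.ctx Y.ctx)) θ ≤ Y.pred}

/-- The identity: the direct image of the predicate under the diagonal. -/
noncomputable def id (X : IntRel P) : Hom X X :=
  ⟨act P (Rel.graph (Rel.diag X.ctx)) X.pred, by
    rw [← act_comp, ← act_comp, ← Rel.graph_comp, ← Rel.graph_comp, lift_fst, lift_snd,
      Rel.graph_id, act_id]
    exact ⟨le_rfl, le_rfl⟩⟩

variable [P.LaxBraided] [IsAjax P]

/-- The composite: the wiring diagram for the composition, applied to the two relations. -/
noncomputable def comp {X Y Z : IntRel P} (θ : Hom X Y) (η : Hom Y Z) : Hom X Z :=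
  ⟨act P (Rel.wire X.ctx Y.ctx Z.ctx) (lax P θ.1 η.1), by
    rw [← act_comp]
    refine (act_le_act P (Rel.wire_fst_le _ _ _) _).trans ?_
    rw [act_comp]
    exact (act_mono P _ (act_fst_le P _ _)).trans θ.2.1, by
    rw [← act_comp]
    refine (act_le_act P (Rel.wire_snd_le _ _ _) _).trans ?_
    rw [act_comp]
    exact (act_mono P _ (act_snd_le P _ _)).trans η.2.2⟩

theorem id_comp {X Y : IntRel P} (θ : Hom X Y) : comp (id X) θ = θ := by
  have h : (comp (id X) θ).1 = act P ((Rel.graph (Rel.diag X.ctx) ⊗ₘ 𝟙 _) ≫ Rel.wire _ _ _)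
      (lax P X.pred θ.1) := by
    rw [act_comp, act_lax, act_id]; rfl
  refine Subtype.ext (h.trans (le_antisymm ?_ ?_))
  · exact (act_le_act P (Rel.diag_wire_le _ _) _).trans (act_snd_le P _ _)
  · refine (le_act_diag P θ.1).trans ((act_le_act P (Rel.cograph_diag_le_left _ _) _).trans ?_)
    rw [act_comp, act_lax, act_id]
    exact act_mono P _ (lax_mono P θ.2.1 le_rfl)

theorem comp_id {X Y : IntRel P} (θ : Hom X Y) : comp θ (id Y) = θ := by
  have h : (comp θ (id Y)).1 = act P ((𝟙 _ ⊗ₘ Rel.graph (Rel.diag Y.ctx)) ≫ Rel.wire _ _ _)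
      (lax P θ.1 Y.pred) := by
    rw [act_comp, act_lax, act_id]; rfl
  refine Subtype.ext (h.trans (le_antisymm ?_ ?_))
  · exact (act_le_act P (Rel.wire_diag_le _ _) _).trans (act_fst_le P _ _)
  · refine (le_act_diag P θ.1).trans ((act_le_act P (Rel.cograph_diag_le_right _ _) _).trans ?_)
    rw [act_comp, act_lax, act_id]
    exact act_mono P _ (lax_mono P le_rfl θ.2.2)

theorem assoc {W X Y Z : IntRel P} (θ : Hom W X) (η : Hom X Y) (ζ : Hom Y Z) :
    comp (comp θ η) ζ = comp θ (comp η ζ) := by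
  refine Subtype.ext ?_
  have h₁ : (comp (comp θ η) ζ).1 = act P ((Rel.wire W.ctx X.ctx Y.ctx ⊗ₘ 𝟙 _) ≫
      Rel.wire W.ctx Y.ctx Z.ctx) (lax P (lax P θ.1 η.1) ζ.1) := by
    rw [act_comp, act_lax, act_id]; rfl
  have h₂ : (comp θ (comp η ζ)).1 = act P ((𝟙 _ ⊗ₘ Rel.wire X.ctx Y.ctx Z.ctx) ≫
      Rel.wire W.ctx X.ctx Z.ctx) (lax P θ.1 (lax P η.1 ζ.1)) := by
    rw [act_comp, act_lax, act_id]; rfl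
  rw [h₁, h₂, Rel.wire_assoc, act_comp, act_assoc]

/-- The po-category of internal relations. -/
noncomputable instance : PoCategory.{w} (IntRel P) where
  Hom := Hom
  id := id
  comp := comp
  id_comp := id_comp
  comp_id := comp_id
  assoc := assoc
  homOrder _ _ := Subtype.partialOrder _
  comp_mono hf hg := act_mono P _ (lax_mono P hf hg)

end IntRel

/-! ### Left adjoints and regular po-categories -/

/-- The category of left adjoints in a po-category: it has the same objects. -/
@[ext]
structure LAdj (C : Type u) where
  as : C

/-- The morphisms of `LAdj C` are the morphisms of `C` that have a right adjoint. -/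
instance {C : Type u} [PoCategory.{v} C] : Category.{v} (LAdj C) where
  Hom X Y := {f : X.as ⟶ Y.as // ∃ g : Y.as ⟶ X.as, Adj f g}
  id X := ⟨𝟙 X.as, 𝟙 X.as, by simp [Adj]⟩
  comp {X Y Z} f f' := ⟨f.1 ≫ f'.1, by
    obtain ⟨g, h₁, h₂⟩ := f.2
    obtain ⟨g', h₁', h₂'⟩ := f'.2
    refine ⟨g' ≫ g, h₁.trans ?_, le_trans ?_ h₂'⟩
    · have := PoCategory.comp_mono (le_refl f.1) (PoCategory.comp_mono h₁' (le_refl g))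
      simpa using this
    · have := PoCategory.comp_mono (le_refl g') (PoCategory.comp_mono h₂ (le_refl f'.1))
      simpa using this⟩
  id_comp f := Subtype.ext (Category.id_comp f.1)
  comp_id f := Subtype.ext (Category.comp_id f.1)
  assoc f g h := Subtype.ext (Category.assoc f.1 g.1 h.1)

/-- A po-category is regular if it is isomorphic to the relations po-category of a regular
category. -/
def IsRegularPoCategory (𝒞 : Type u) [PoCategory.{v} 𝒞] : Prop :=
  ∃ (R : Type u) (_ : Category.{v} R) (_ : CartesianMonoidalCategory R) (_ : Regular R),
    Nonempty (PoIso 𝒞 (Rel R))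

end RegLogic

open RegLogic

namespace RegLogic

-- The proof passes through allegories and has two independent halves. The first is the theorem of
-- Freyd and Scedrov: a unitary tabular allegory `A` is the po-category of relations of its category
-- of maps, and that category is regular. The second shows that the internal relations form a
-- unitary tabular allegory, for a context category `C` that may be any regular category.
--
-- For the first half, the modular law forces every right adjoint to be the converse
-- (`conv_eq_of_adj`), so `LAdj A` is exactly the category of maps. A tabulation of `R` represents
-- the pairs of maps `(a, b)` with `a† ≫ b ≤ R` (`Tabulates.exists_lift`, `Tabulates.hom_ext`).
-- Tabulating `f ≫ g†` gives pullbacks, and tabulating `f† ≫ f` gives images. Regular epimorphisms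
-- are the maps with `e† ≫ e = 𝟙` (`isRegularEpi_iff`), a condition whose stability under pullback
-- is a computation, and the unit of the allegory is a terminal object (`regular_ladj`). Morphisms
-- `X ⟶ Y` of `A` then correspond, through their tabulations, to subobjects of `X ⊗ Y`; the
-- bijection respects order, identities and composition, and it is the identity on objects, which
-- makes it a strict isomorphism (`poIsoRel`).
--
-- For the second half, graphs and cographs turn the ajax functor into a hyperdoctrine with direct
-- images `push`, inverse images `pull` and finite conjunctions, satisfying Beck–Chevalley and
-- Frobenius. This supports a Kripke–Joyal semantics for regular logic: `Forces α θ a b` says that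
-- the generalized elements `a`, `b` are related by `θ` on the predicate `α`, and existential
-- witnesses live on covers, that is, on morphisms `e` with `push e β = α`. Once composition and
-- identity are translated (`forces_comp`, `forces_id`), the allegory axioms are checked as for
-- relations between sets. A relation `θ` is tabulated by the projections from the context `Γ₁ ⊗ Γ₂`
-- carrying the predicate `θ`, and the empty context with the true predicate is a unit.

attribute [gcongr] PoCategory.comp_mono

/-! ### Allegories -/

/-- An allegory: a po-category with an involution that reverses the direction of the morphisms and
with binary meets in the hom-posets, such that the modular law holds. -/
class Allegory (A : Type u) [PoCategory.{v} A] where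
  conv : ∀ {X Y : A}, (X ⟶ Y) → (Y ⟶ X)
  meet : ∀ {X Y : A}, (X ⟶ Y) → (X ⟶ Y) → (X ⟶ Y)
  conv_conv : ∀ {X Y : A} (f : X ⟶ Y), conv (conv f) = f
  conv_mono : ∀ {X Y : A} {f g : X ⟶ Y}, f ≤ g → conv f ≤ conv g
  conv_comp : ∀ {X Y Z : A} (f : X ⟶ Y) (g : Y ⟶ Z), conv (f ≫ g) = conv g ≫ conv f
  meet_le_left : ∀ {X Y : A} (f g : X ⟶ Y), meet f g ≤ f
  meet_le_right : ∀ {X Y : A} (f g : X ⟶ Y), meet f g ≤ g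
  le_meet : ∀ {X Y : A} {f g h : X ⟶ Y}, h ≤ f → h ≤ g → h ≤ meet f g
  modular : ∀ {X Y Z : A} (f : X ⟶ Y) (g : Y ⟶ Z) (h : X ⟶ Z),
    meet (f ≫ g) h ≤ f ≫ meet g (conv f ≫ h)

namespace Allegory

local postfix:max "†" => Allegory.conv

local infixl:69 " ⊓' " => Allegory.meet

/-! ### Maps and tabulations in an allegory. -/

section Basic

variable {A : Type u} [PoCategory.{v} A] [Allegory A] {W X Y Z : A}

attribute [simp] conv_conv conv_comp
attribute [gcongr] conv_mono

@[simp] theorem conv_id : (𝟙 X : X ⟶ X)† = 𝟙 X := by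
  have h := conv_comp (𝟙 X : X ⟶ X)† (𝟙 X)
  simpa using h.symm

theorem conv_le_iff {f : X ⟶ Y} {g : Y ⟶ X} : f† ≤ g ↔ f ≤ g† :=
  ⟨fun h => by simpa using conv_mono h, fun h => by simpa using conv_mono h⟩

@[gcongr]
theorem meet_mono {f f' g g' : X ⟶ Y} (h : f ≤ f') (h' : g ≤ g') : f ⊓' g ≤ f' ⊓' g' :=
  le_meet ((meet_le_left _ _).trans h) ((meet_le_right _ _).trans h')

/-- A monotone involution is an order isomorphism, so it preserves meets. -/
theorem conv_meet (f g : X ⟶ Y) : (f ⊓' g)† = f† ⊓' g† := by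
  refine le_antisymm (le_meet (conv_mono (meet_le_left _ _)) (conv_mono (meet_le_right _ _))) ?_
  rw [← conv_conv (f† ⊓' g†)]
  refine conv_mono (le_meet ?_ ?_)
  · exact conv_le_iff.2 (meet_le_left _ _)
  · exact conv_le_iff.2 (meet_le_right _ _)

/-- This is the modular law read through the involution. -/
theorem modular_right (f : X ⟶ Y) (g : Y ⟶ Z) (h : X ⟶ Z) :
    (f ≫ g) ⊓' h ≤ (f ⊓' (h ≫ g†)) ≫ g := by
  have := conv_mono (modular g† f† h†)
  simpa [conv_meet] using this

/-- The first factor of a composite above the identity is entire. -/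
theorem entire_of_le_comp {f : X ⟶ Y} {g : Y ⟶ X} (h : 𝟙 X ≤ f ≫ g) : 𝟙 X ≤ f ≫ f† :=
  calc 𝟙 X ≤ (f ≫ g) ⊓' 𝟙 X := le_meet h le_rfl
    _ ≤ f ≫ (g ⊓' (f† ≫ 𝟙 X)) := modular _ _ _
    _ ≤ f ≫ f† := by
      rw [Category.comp_id]
      exact PoCategory.comp_mono le_rfl (meet_le_right _ _)

/-- A map in an allegory: an entire and simple morphism. -/
structure IsMap (f : X ⟶ Y) : Prop where
  entire : 𝟙 X ≤ f ≫ f†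
  simple : f† ≫ f ≤ 𝟙 Y

/-- Postcomposition with a map is left adjoint to postcomposition with its converse. This half needs
only `entire`; the next one needs only `simple`. -/
theorem IsMap.comp_conv_le {f : X ⟶ Y} (hf : IsMap f) {g : W ⟶ X} {h : W ⟶ Y} (H : g ≫ f ≤ h) :
    g ≤ h ≫ f† :=
  calc g = g ≫ 𝟙 X := (Category.comp_id g).symm
    _ ≤ g ≫ f ≫ f† := PoCategory.comp_mono le_rfl hf.entire
    _ = (g ≫ f) ≫ f† := (Category.assoc _ _ _).symm
    _ ≤ _ := PoCategory.comp_mono H le_rfl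

theorem IsMap.comp_le {f : X ⟶ Y} (hf : IsMap f) {g : W ⟶ X} {h : W ⟶ Y} (H : g ≤ h ≫ f†) :
    g ≫ f ≤ h :=
  calc g ≫ f ≤ (h ≫ f†) ≫ f := PoCategory.comp_mono H le_rfl
    _ = h ≫ f† ≫ f := Category.assoc _ _ _
    _ ≤ h ≫ 𝟙 Y := PoCategory.comp_mono le_rfl hf.simple
    _ = h := Category.comp_id h

theorem IsMap.comp_le_iff {f : X ⟶ Y} (hf : IsMap f) {g : W ⟶ X} {h : W ⟶ Y} :
    g ≫ f ≤ h ↔ g ≤ h ≫ f† := ⟨hf.comp_conv_le, hf.comp_le⟩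

theorem IsMap.conv_comp_le_iff {f : X ⟶ Y} (hf : IsMap f) {g : X ⟶ W} {h : Y ⟶ W} :
    f† ≫ g ≤ h ↔ g ≤ f ≫ h := by
  have := hf.comp_le_iff (g := g†) (h := h†)
  constructor
  · intro H
    have := this.1 (by simpa using conv_mono H)
    simpa using conv_mono this
  · intro H
    have := this.2 (by simpa using conv_mono H)
    simpa using conv_mono this

theorem IsMap.comp {f : X ⟶ Y} {g : Y ⟶ Z} (hf : IsMap f) (hg : IsMap g) : IsMap (f ≫ g) := by
  constructor
  · rw [conv_comp, ← Category.assoc, ← hf.comp_le_iff, Category.id_comp]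
    exact hg.comp_conv_le le_rfl
  · rw [conv_comp, Category.assoc, hg.conv_comp_le_iff, Category.comp_id, hf.conv_comp_le_iff]

/-- Maps are discretely ordered, because `g ≤ f ≫ f† ≫ g ≤ f ≫ g† ≫ g ≤ f`. Equations between maps
can therefore be proved as a single inequality. -/
theorem IsMap.eq_of_le {f g : X ⟶ Y} (hf : IsMap f) (hg : IsMap g) (h : f ≤ g) : f = g := by
  refine le_antisymm h ?_
  have h₁ : g† ≫ f ≤ 𝟙 Y := (PoCategory.comp_mono le_rfl h).trans hg.simple
  calc g = 𝟙 X ≫ g := (Category.id_comp g).symm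
    _ ≤ (f ≫ f†) ≫ g := PoCategory.comp_mono hf.entire le_rfl
    _ ≤ (f ≫ g†) ≫ g := PoCategory.comp_mono (PoCategory.comp_mono le_rfl (conv_mono h)) le_rfl
    _ ≤ f := hg.comp_le le_rfl

/-- In an allegory the right adjoint of a morphism is its converse. -/
theorem conv_eq_of_adj {f : X ⟶ Y} {g : Y ⟶ X} (h : Adj f g) : g = f† := by
  have key : ∀ {X Y : A} {f : X ⟶ Y} {g : Y ⟶ X}, Adj f g → g ≤ f† := by
    intro X Y f g h
    -- By the modular law, the smaller morphism `g ⊓' f†` still satisfies the unit inequality with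
    -- `f`; the counit inequality of `g` then pushes `g` below it.
    have h₁ : 𝟙 X ≤ f ≫ (g ⊓' f†) := by
      refine (le_meet h.1 le_rfl).trans ((modular _ _ _).trans ?_)
      rw [Category.comp_id]
    calc g = g ≫ 𝟙 X := (Category.comp_id g).symm
      _ ≤ g ≫ f ≫ (g ⊓' f†) := PoCategory.comp_mono le_rfl h₁
      _ = (g ≫ f) ≫ (g ⊓' f†) := (Category.assoc _ _ _).symm
      _ ≤ 𝟙 Y ≫ (g ⊓' f†) := PoCategory.comp_mono h.2 le_rfl
      _ = g ⊓' f† := Category.id_comp _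
      _ ≤ f† := meet_le_right _ _
  refine le_antisymm (key h) ?_
  -- The converse of an adjunction is again one, and applying `key` to it gives the other
  -- inequality.
  have h' : Adj g† f† := ⟨by simpa using conv_mono h.1, by simpa using conv_mono h.2⟩
  simpa using key h'

theorem exists_adj_iff {f : X ⟶ Y} : (∃ g, Adj f g) ↔ IsMap f := by
  constructor
  · rintro ⟨g, h⟩
    obtain rfl := conv_eq_of_adj h
    exact ⟨h.1, h.2⟩
  · exact fun h => ⟨f†, h.entire, h.simple⟩

/-- A pair of maps with a common domain that are jointly injective and whose image is `R`. -/
structure Tabulates (f : Z ⟶ X) (g : Z ⟶ Y) (R : X ⟶ Y) : Prop where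
  left : IsMap f
  right : IsMap g
  conv_comp_eq : f† ≫ g = R
  meet_le : (f ≫ f†) ⊓' (g ≫ g†) ≤ 𝟙 Z

/-- Both sides say that `R` holds between `a w` and `b w` for every `w`. The right-hand form is the
one from which the modular law extracts an entire morphism. -/
theorem conv_comp_le_iff {a : W ⟶ X} {b : W ⟶ Y} (ha : IsMap a) (hb : IsMap b) {R : X ⟶ Y} :
    a† ≫ b ≤ R ↔ 𝟙 W ≤ a ≫ R ≫ b† := by
  rw [ha.conv_comp_le_iff, ← Category.id_comp b, hb.comp_le_iff, Category.id_comp, Category.assoc]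

/-- Composition with a map preserves meets. -/
theorem IsMap.meet_comp_le {k : W ⟶ X} (hk : IsMap k) (f g : X ⟶ Y) :
    (k ≫ f) ⊓' (k ≫ g) ≤ k ≫ (f ⊓' g) :=
  (modular _ _ _).trans (PoCategory.comp_mono le_rfl
    (meet_mono le_rfl (hk.conv_comp_le_iff.2 le_rfl)))

/-- Since `h` lies below both `k ≫ f ≫ f†` and `k ≫ g ≫ g†`, and composition with the map `k`
preserves meets, joint injectivity gives `h ≤ k`. -/
theorem Tabulates.hom_ext {f : Z ⟶ X} {g : Z ⟶ Y} {R : X ⟶ Y} (t : Tabulates f g R) {h k : W ⟶ Z}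
    (hh : IsMap h) (hk : IsMap k) (hf : h ≫ f = k ≫ f) (hg : h ≫ g = k ≫ g) : h = k := by
  refine hh.eq_of_le hk ?_
  calc h ≤ (k ≫ f ≫ f†) ⊓' (k ≫ g ≫ g†) := by
        rw [← Category.assoc, ← Category.assoc]
        exact le_meet (t.left.comp_conv_le hf.le) (t.right.comp_conv_le hg.le)
    _ ≤ k ≫ ((f ≫ f†) ⊓' (g ≫ g†)) := hk.meet_comp_le _ _
    _ ≤ k ≫ 𝟙 Z := PoCategory.comp_mono le_rfl t.meet_le
    _ = k := Category.comp_id k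

/-- The lift is the relation `(a ≫ f†) ⊓' (b ≫ g†)`, which pairs `w` with those `z` for which `f z =
a w` and `g z = b w`. It is entire because `(a, b)` lies in `R`, by the modular law, and simple
because the tabulation is jointly injective. -/
theorem Tabulates.exists_lift {f : Z ⟶ X} {g : Z ⟶ Y} {R : X ⟶ Y} (t : Tabulates f g R) {a : W ⟶ X}
    {b : W ⟶ Y} (ha : IsMap a) (hb : IsMap b) (hab : a† ≫ b ≤ R) :
    ∃ h : W ⟶ Z, IsMap h ∧ h ≫ f = a ∧ h ≫ g = b := by
  have hm : IsMap ((a ≫ f†) ⊓' (b ≫ g†)) := by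
    constructor
    · rw [conv_comp_le_iff ha hb, ← t.conv_comp_eq] at hab
      refine entire_of_le_comp (g := g ≫ b†) ?_
      calc 𝟙 W ≤ ((a ≫ f†) ≫ (g ≫ b†)) ⊓' 𝟙 W := le_meet (by simpa using hab) le_rfl
        _ ≤ _ := modular_right _ _ _
        _ = _ := by simp
    · refine le_trans (le_meet ?_ ?_) t.meet_le
      · calc _ ≤ (a ≫ f†)† ≫ (a ≫ f†) := PoCategory.comp_mono (conv_mono (meet_le_left _ _))
              (meet_le_left _ _)
          _ = f ≫ a† ≫ a ≫ f† := by simp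
          _ ≤ f ≫ f† := PoCategory.comp_mono le_rfl (ha.conv_comp_le_iff.2 le_rfl)
      · calc _ ≤ (b ≫ g†)† ≫ (b ≫ g†) := PoCategory.comp_mono (conv_mono (meet_le_right _ _))
              (meet_le_right _ _)
          _ = g ≫ b† ≫ b ≫ g† := by simp
          _ ≤ g ≫ g† := PoCategory.comp_mono le_rfl (hb.conv_comp_le_iff.2 le_rfl)
  exact ⟨_, hm, (hm.comp t.left).eq_of_le ha (t.left.comp_le (meet_le_left _ _)),
    (hm.comp t.right).eq_of_le hb (t.right.comp_le (meet_le_right _ _))⟩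

theorem Tabulates.conv_comp_le_of_lift {f : Z ⟶ X} {g : Z ⟶ Y} {R : X ⟶ Y} (t : Tabulates f g R)
    {h : W ⟶ Z} (hh : IsMap h) : (h ≫ f)† ≫ h ≫ g ≤ R := by
  rw [← t.conv_comp_eq, conv_comp, Category.assoc]
  exact PoCategory.comp_mono le_rfl (hh.conv_comp_le_iff.2 le_rfl)

/-- A commutative square of maps, in terms of the relation between its vertices. -/
theorem comp_eq_comp_iff {a : W ⟶ X} {b : W ⟶ Y} {f : X ⟶ Z} {g : Y ⟶ Z} (ha : IsMap a)
    (hb : IsMap b) (hf : IsMap f) (hg : IsMap g) : a ≫ f = b ≫ g ↔ a† ≫ b ≤ f ≫ g† := by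
  rw [← hg.comp_le_iff, Category.assoc, ha.conv_comp_le_iff]
  exact ⟨fun h => h.ge, fun h => ((hb.comp hg).eq_of_le (ha.comp hf) h).symm⟩

end Basic

/-! ### Left adjoints as maps. -/

section LAdj

variable {A : Type u} [PoCategory.{v} A]

theorem comp_coe {X Y Z : LAdj A} (f : X ⟶ Y) (g : Y ⟶ Z) : (f ≫ g).1 = f.1 ≫ g.1 := rfl

theorem id_coe (X : LAdj A) : (𝟙 X : X ⟶ X).1 = 𝟙 X.as := rfl

variable [Allegory A]

theorem isMap_coe {X Y : LAdj A} (f : X ⟶ Y) : IsMap f.1 := exists_adj_iff.1 f.2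

/-- A map, as a morphism of the category of left adjoints. -/
def IsMap.toHom {X Y : LAdj A} {f : X.as ⟶ Y.as} (hf : IsMap f) : X ⟶ Y :=
  ⟨f, exists_adj_iff.2 hf⟩

theorem comp_eq_comp_iff_coe {W X Y Z : LAdj A} {a : W ⟶ X} {b : W ⟶ Y} {f : X ⟶ Z} {g : Y ⟶ Z} :
    a ≫ f = b ≫ g ↔ a.1† ≫ b.1 ≤ f.1 ≫ g.1† := by
  rw [← comp_eq_comp_iff (isMap_coe a) (isMap_coe b) (isMap_coe f) (isMap_coe g)]
  exact Subtype.ext_iff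

end LAdj

/-- An allegory is tabular if every morphism has a tabulation. -/
class IsTabular (A : Type u) [PoCategory.{v} A] [Allegory A] : Prop where
  exists_tabulates : ∀ {X Y : A} (R : X ⟶ Y), ∃ (Z : A) (f : Z ⟶ X) (g : Z ⟶ Y), Tabulates f g R

/-- An allegory is unitary if it has an object whose greatest endomorphism is the identity, and to
which every object has an entire morphism. -/
class IsUnitary (A : Type u) [PoCategory.{v} A] [Allegory A] : Prop where
  exists_unit : ∃ U : A, (∀ R : U ⟶ U, R ≤ 𝟙 U) ∧ ∀ X : A, ∃ p : X ⟶ U, 𝟙 X ≤ p ≫ p†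

/-! ### Pullbacks, images and regular epimorphisms in the category of maps. -/

section Tabular

variable {A : Type u} [PoCategory.{v} A] [Allegory A]

theorem exists_tabulates_hom [IsTabular A] {X Y : LAdj A} (R : X.as ⟶ Y.as) :
    ∃ (Z : LAdj A) (f : Z ⟶ X) (g : Z ⟶ Y), Tabulates f.1 g.1 R := by
  obtain ⟨Z, f, g, t⟩ := IsTabular.exists_tabulates R
  exact ⟨⟨Z⟩, t.left.toHom, t.right.toHom, t⟩

theorem Tabulates.exists_lift_hom {W X Y Z : LAdj A} {f : Z ⟶ X} {g : Z ⟶ Y} {R : X.as ⟶ Y.as}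
    (t : Tabulates f.1 g.1 R) (a : W ⟶ X) (b : W ⟶ Y) (hab : a.1† ≫ b.1 ≤ R) :
    ∃ h : W ⟶ Z, h ≫ f = a ∧ h ≫ g = b := by
  obtain ⟨h, hh, h₁, h₂⟩ := t.exists_lift (isMap_coe a) (isMap_coe b) hab
  exact ⟨hh.toHom, Subtype.ext h₁, Subtype.ext h₂⟩

theorem Tabulates.hom_ext' {W X Y Z : LAdj A} {f : Z ⟶ X} {g : Z ⟶ Y} {R : X.as ⟶ Y.as}
    (t : Tabulates f.1 g.1 R) {h k : W ⟶ Z} (hf : h ≫ f = k ≫ f) (hg : h ≫ g = k ≫ g) : h = k :=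
  Subtype.ext (t.hom_ext (isMap_coe h) (isMap_coe k) (congrArg Subtype.val hf)
    (congrArg Subtype.val hg))

/-- A tabulation of `f ≫ g†` is a pullback of `f` and `g`. -/
theorem Tabulates.isPullback {X Y Z W : LAdj A} {f : X ⟶ Z} {g : Y ⟶ Z} {p : W ⟶ X} {q : W ⟶ Y}
    (t : Tabulates p.1 q.1 (f.1 ≫ g.1†)) : IsPullback p q f g := by
  have w : p ≫ f = q ≫ g := comp_eq_comp_iff_coe.2 t.conv_comp_eq.le
  refine ⟨⟨w⟩, ⟨PullbackCone.IsLimit.mk w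
    (fun s => (t.exists_lift_hom s.fst s.snd (comp_eq_comp_iff_coe.1 s.condition)).choose)
    (fun s => (t.exists_lift_hom s.fst s.snd (comp_eq_comp_iff_coe.1 s.condition)).choose_spec.1)
    (fun s => (t.exists_lift_hom s.fst s.snd (comp_eq_comp_iff_coe.1 s.condition)).choose_spec.2)
    (fun s m h₁ h₂ => t.hom_ext' ?_ ?_)⟩⟩
  · rw [h₁, (t.exists_lift_hom s.fst s.snd (comp_eq_comp_iff_coe.1 s.condition)).choose_spec.1]
  · rw [h₂, (t.exists_lift_hom s.fst s.snd (comp_eq_comp_iff_coe.1 s.condition)).choose_spec.2]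

/-- An inverse is a right adjoint, and right adjoints are converses. -/
theorem conv_coe_eq_of_iso {X Y : LAdj A} (i : X ≅ Y) : i.hom.1† = i.inv.1 := by
  refine (conv_eq_of_adj ⟨?_, ?_⟩).symm
  · rw [← comp_coe, i.hom_inv_id, id_coe]
  · rw [← comp_coe, i.inv_hom_id, id_coe]

/-- A map `e` with `e† ≫ e = 𝟙` is a coequalizer of every pair of maps `p`, `q` that tabulates
`e ≫ e†`. -/
theorem nonempty_isColimit {W X Y : LAdj A} {p q : W ⟶ X} {e : X ⟶ Y} (he : e.1† ≫ e.1 = 𝟙 Y.as)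
    (hpq : p.1† ≫ q.1 = e.1 ≫ e.1†) :
    ∃ w : p ≫ e = q ≫ e, Nonempty (IsColimit (Cofork.ofπ e w)) := by
  refine ⟨comp_eq_comp_iff_coe.2 hpq.le, ⟨Cofork.IsColimit.mk' _ fun s => ?_⟩⟩
  -- The map `s.π` identifies everything that `e` identifies, since `p` and `q` generate `e ≫ e†`.
  have hs : (e.1 ≫ e.1†) ≫ s.π.1 ≤ s.π.1 := by
    rw [← hpq, Category.assoc, (isMap_coe p).conv_comp_le_iff]
    exact (congrArg Subtype.val s.condition).ge
  -- The induced map out of `Y` picks any preimage under `e` and applies `s.π`. Surjectivity of `e`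
  -- makes it entire, and `hs` makes it single-valued.
  have hd : IsMap (e.1† ≫ s.π.1) := by
    constructor
    · calc 𝟙 Y.as = e.1† ≫ 𝟙 _ ≫ e.1 := by rw [Category.id_comp, he]
        _ ≤ e.1† ≫ (s.π.1 ≫ s.π.1†) ≫ e.1 := PoCategory.comp_mono le_rfl
          (PoCategory.comp_mono (isMap_coe s.π).entire le_rfl)
        _ = _ := by simp
    · rw [conv_comp, conv_conv, Category.assoc, (isMap_coe s.π).conv_comp_le_iff, Category.comp_id,
        ← Category.assoc]
      exact hs
  refine ⟨hd.toHom, ?_, fun {m} hm => Subtype.ext ?_⟩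
  · refine Subtype.ext ((((isMap_coe e).comp hd).eq_of_le (isMap_coe s.π) ?_))
    rw [← Category.assoc]
    exact hs
  · have hm : e ≫ m = s.π := hm
    change m.1 = e.1† ≫ s.π.1
    rw [← hm, comp_coe, ← Category.assoc, he, Category.id_comp]

variable [IsTabular A]

/-- A tabulation of `f ≫ g†` is one pullback; any other differs from it by an isomorphism, which
cancels against its converse. -/
theorem conv_comp_eq_of_isPullback {X Y Z W : LAdj A} {f : X ⟶ Z} {g : Y ⟶ Z} {p : W ⟶ X}
    {q : W ⟶ Y} (h : IsPullback p q f g) : p.1† ≫ q.1 = f.1 ≫ g.1† := by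
  obtain ⟨V, p', q', t⟩ := exists_tabulates_hom (f.1 ≫ g.1†)
  let i : W ≅ V := h.isoIsPullback _ _ t.isPullback
  have h₁ : i.hom ≫ p' = p := h.isoIsPullback_hom_fst _ _ t.isPullback
  have h₂ : i.hom ≫ q' = q := h.isoIsPullback_hom_snd _ _ t.isPullback
  rw [← h₁, ← h₂, comp_coe, comp_coe, conv_comp, Category.assoc, ← Category.assoc i.hom.1†,
    conv_coe_eq_of_iso, ← comp_coe, i.inv_hom_id, id_coe, Category.id_comp, t.conv_comp_eq]

instance : HasPullbacks (LAdj A) :=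
  haveI : ∀ {X Y Z : LAdj A} {f : X ⟶ Z} {g : Y ⟶ Z}, HasLimit (cospan f g) := fun {X Y Z f g} => by
    obtain ⟨V, p, q, t⟩ := exists_tabulates_hom (f.1 ≫ g.1†)
    exact t.isPullback.hasPullback
  hasPullbacks_of_hasLimit_cospan _

/-- The relation `m ≫ m†` is tabulated by the kernel pair of `m`, whose two legs coincide, and `p† ≫
p ≤ 𝟙` for any map `p`. -/
theorem comp_conv_of_mono {X Y : LAdj A} (m : X ⟶ Y) [Mono m] : m.1 ≫ m.1† = 𝟙 X.as := by
  refine le_antisymm ?_ (isMap_coe m).entire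
  obtain ⟨V, p, q, t⟩ := exists_tabulates_hom (m.1 ≫ m.1†)
  obtain rfl : p = q := (cancel_mono m).1 t.isPullback.w
  rw [← t.conv_comp_eq]
  exact (isMap_coe p).simple

/-- The factorization of a map through its image. -/
theorem exists_image_factorization {X Y : LAdj A} (f : X ⟶ Y) :
    ∃ (I : LAdj A) (e : X ⟶ I) (m : I ⟶ Y), e ≫ m = f ∧ e.1† ≫ e.1 = 𝟙 I.as ∧ Mono m ∧
      m.1† ≫ m.1 = f.1† ≫ f.1 := by
  obtain ⟨I, m, m', t⟩ := exists_tabulates_hom (f.1† ≫ f.1)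
  -- As `f† ≫ f` lies below the identity, the two legs of its tabulation are comparable, hence
  -- equal; the common leg is the inclusion of the image.
  obtain rfl : m = m' := by
    refine Subtype.ext ((isMap_coe m').eq_of_le (isMap_coe m) ?_).symm
    rw [← Category.comp_id m.1, ← (isMap_coe m).conv_comp_le_iff, t.conv_comp_eq]
    exact (isMap_coe f).simple
  obtain ⟨e, he, -⟩ := t.exists_lift_hom f f le_rfl
  have : Mono m := ⟨fun a b h => t.hom_ext' h h⟩
  have hm := comp_conv_of_mono m
  have he' : e.1 = f.1 ≫ m.1† := by
    rw [← he, comp_coe, Category.assoc, hm, Category.comp_id]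
  refine ⟨I, e, m, he, ?_, this, t.conv_comp_eq⟩
  rw [he', conv_comp, conv_conv, Category.assoc, ← Category.assoc f.1†, ← t.conv_comp_eq,
    Category.assoc, hm, Category.comp_id, hm]

/-- If `e` is a regular epimorphism, the inclusion of its image is both monic and strong epic, hence
invertible, and `e† ≫ e` is computed from it. Conversely, `e` is a coequalizer of the tabulation of
`e ≫ e†`. -/
theorem isRegularEpi_iff {X Y : LAdj A} (e : X ⟶ Y) : IsRegularEpi e ↔ e.1† ≫ e.1 = 𝟙 Y.as := by
  constructor
  · intro h
    obtain ⟨I, c, m, hc, -, hm, h'⟩ := exists_image_factorization e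
    have : IsIso m := by
      have : StrongEpi (c ≫ m) := hc ▸ inferInstance
      have := strongEpi_of_strongEpi c m
      exact isIso_of_mono_of_strongEpi m
    rw [← h', show m.1† = (inv m).1 from conv_coe_eq_of_iso (asIso m), ← comp_coe,
      IsIso.inv_hom_id, id_coe]
  · intro h
    obtain ⟨V, p, q, t⟩ := exists_tabulates_hom (e.1 ≫ e.1†)
    obtain ⟨w, ⟨hw⟩⟩ := nonempty_isColimit h t.conv_comp_eq
    exact ⟨⟨⟨V, p, q, w, hw⟩⟩⟩

/-- Every endomorphism of the unit lies below its identity. This makes the entire morphism `p` into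
the unit simple, and bounds any other map `m` by `p ≫ p† ≫ m ≤ p`. -/
instance [IsUnitary A] : HasTerminal (LAdj A) := by
  obtain ⟨U, hU, hp⟩ := IsUnitary.exists_unit (A := A)
  have hm : ∀ X : LAdj A, IsMap (hp X.as).choose := fun X => ⟨(hp X.as).choose_spec, hU _⟩
  refine IsTerminal.hasTerminal (X := (⟨U⟩ : LAdj A)) (IsTerminal.ofUniqueHom
    (fun X => (hm X).toHom) fun X m => Subtype.ext ((isMap_coe m).eq_of_le (hm X) ?_))
  calc m.1 = 𝟙 X.as ≫ m.1 := (Category.id_comp _).symm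
    _ ≤ ((hp X.as).choose ≫ (hp X.as).choose†) ≫ m.1 :=
      PoCategory.comp_mono (hm X).entire le_rfl
    _ = (hp X.as).choose ≫ (hp X.as).choose† ≫ m.1 := Category.assoc _ _ _
    _ ≤ (hp X.as).choose ≫ 𝟙 U := PoCategory.comp_mono le_rfl (hU _)
    _ = (hp X.as).choose := Category.comp_id _

/-- Regular epimorphisms are stable under pullback. -/
theorem conv_comp_eq_id_of_isPullback {X Y Z W : LAdj A} {f : X ⟶ Z} {g : Y ⟶ Z} {p : W ⟶ X}
    {q : W ⟶ Y} (h : IsPullback p q f g) (hg : g.1† ≫ g.1 = 𝟙 Z.as) : p.1† ≫ p.1 = 𝟙 X.as := by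
  refine le_antisymm (isMap_coe p).simple ?_
  -- Surjectivity of `g` is inserted between `f` and `f†`, and `p† ≫ q = f ≫ g†` moves the result
  -- across the square. This makes `p†` the first factor of a composite above the identity.
  have h₁ : 𝟙 X.as ≤ p.1† ≫ q.1 ≫ q.1† ≫ p.1 :=
    calc 𝟙 X.as ≤ f.1 ≫ f.1† := (isMap_coe f).entire
      _ = f.1 ≫ (g.1† ≫ g.1) ≫ f.1† := by rw [hg, Category.id_comp]
      _ = (f.1 ≫ g.1†) ≫ (f.1 ≫ g.1†)† := by simp
      _ = _ := by rw [← conv_comp_eq_of_isPullback h]; simp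
  simpa using entire_of_le_comp h₁

/-- The category of maps in a unitary tabular allegory is regular. -/
theorem regular_ladj [IsUnitary A] : Regular (LAdj A) where
  toHasFiniteLimits := hasFiniteLimits_of_hasTerminal_and_pullbacks
  hasCoequalizer_of_isKernelPair {X Y Z f g₁ g₂} h := by
    obtain ⟨I, e, m, he, he', hm, -⟩ := exists_image_factorization f
    -- A map and the surjective part of its image factorization have the same kernel pair, because
    -- the remaining factor is monic.
    have h' : IsKernelPair e g₁ g₂ := by
      subst he
      exact h.cancel_right_of_mono
    obtain ⟨w, ⟨hw⟩⟩ := nonempty_isColimit he' (conv_comp_eq_of_isPullback h')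
    exact ⟨⟨⟨_, hw⟩⟩⟩
  regularEpiIsStableUnderBaseChange := by
    constructor
    intro X Y Y' S f g f' g' sq hg
    rw [MorphismProperty.regularEpi_iff, isRegularEpi_iff] at *
    exact conv_comp_eq_id_of_isPullback sq.flip hg

end Tabular

/-! ### The relations in the category of maps of a unitary tabular allegory -/

section Relations

variable {A : Type u} [PoCategory.{v} A] [Allegory A] [IsTabular A]
variable [CartesianMonoidalCategory (LAdj A)] {X Y Z : LAdj A}

/-- The legs of a tabulation are jointly monic, so they define a subobject. Its generalized elements
are described without reference to the chosen tabulation, and later arguments use only this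
description. -/
theorem exists_sub (R : X.as ⟶ Y.as) : ∃ x : Subobject (X ⊗ Y),
    ∀ ⦃U : LAdj A⦄ (a : U ⟶ X) (b : U ⟶ Y), x.Factors (lift a b) ↔ a.1† ≫ b.1 ≤ R := by
  obtain ⟨Z, f, g, t⟩ := exists_tabulates_hom R
  have : Mono (lift f g) := ⟨fun a b h => by
    rw [comp_lift, comp_lift, Rel.lift_inj] at h
    exact t.hom_ext' h.1 h.2⟩
  refine ⟨Subobject.mk (lift f g), fun U a b => ?_⟩
  simp only [Rel.mk_factors, comp_lift, Rel.lift_inj]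
  constructor
  · rintro ⟨k, rfl, rfl⟩
    exact t.conv_comp_le_of_lift (isMap_coe k)
  · exact t.exists_lift_hom a b

/-- The subobject of `X ⊗ Y` given by a tabulation of a morphism from `X` to `Y`. -/
noncomputable def sub (R : X.as ⟶ Y.as) : Subobject (X ⊗ Y) := (exists_sub R).choose

theorem sub_factors {R : X.as ⟶ Y.as} {U : LAdj A} {a : U ⟶ X} {b : U ⟶ Y} :
    (sub R).Factors (lift a b) ↔ a.1† ≫ b.1 ≤ R := (exists_sub R).choose_spec a b

/-- The legs of a tabulation of `R` form the generic pair related by `R`; testing on this pair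
recovers the order of `A`. -/
theorem sub_le_sub_iff {R S : X.as ⟶ Y.as} : sub R ≤ sub S ↔ R ≤ S := by
  rw [Rel.sub_le_iff]
  simp only [sub_factors]
  refine ⟨fun h => ?_, fun h U a b hab => hab.trans h⟩
  obtain ⟨Z, f, g, t⟩ := exists_tabulates_hom R
  rw [← t.conv_comp_eq]
  exact h f g t.conv_comp_eq.le

/-- A jointly monic pair of maps `(a, b)` tabulates `a† ≫ b`. -/
theorem sub_surjective (x : Subobject (X ⊗ Y)) : ∃ R : X.as ⟶ Y.as, sub R = x := by
  let a : (x : LAdj A) ⟶ X := x.arrow ≫ fst X Y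
  let b : (x : LAdj A) ⟶ Y := x.arrow ≫ snd X Y
  have hx : lift a b = x.arrow := lift_comp_fst_snd _
  have t : Tabulates a.1 b.1 (a.1† ≫ b.1) := by
    refine ⟨isMap_coe a, isMap_coe b, rfl, ?_⟩
    -- The legs `p`, `q` tabulate the relation of having equal images under `a` and `b`. They agree
    -- after composition with the monomorphism `x.arrow`, so they are equal and the relation lies
    -- below the identity.
    obtain ⟨Z, p, q, t⟩ := exists_tabulates_hom (X := (x : LAdj A)) (Y := (x : LAdj A))
      ((a.1 ≫ a.1†) ⊓' (b.1 ≫ b.1†))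
    have ha : p ≫ a = q ≫ a :=
      comp_eq_comp_iff_coe.2 (t.conv_comp_eq.le.trans (meet_le_left _ _))
    have hb : p ≫ b = q ≫ b :=
      comp_eq_comp_iff_coe.2 (t.conv_comp_eq.le.trans (meet_le_right _ _))
    obtain rfl : p = q := by
      rw [← cancel_mono x.arrow, ← hx, comp_lift, comp_lift, ha, hb]
    rw [← t.conv_comp_eq]
    exact (isMap_coe p).simple
  refine ⟨a.1† ≫ b.1, Rel.sub_ext fun U c d => sub_factors.trans ⟨fun h => ?_, fun h => ?_⟩⟩
  · obtain ⟨k, rfl, rfl⟩ := t.exists_lift_hom c d h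
    rw [← comp_lift, hx]
    exact Subobject.factors_comp_arrow k
  · have hk := x.factorThru_arrow _ h
    rw [← hx, comp_lift, Rel.lift_inj] at hk
    generalize x.factorThru _ h = k at hk
    obtain ⟨rfl, rfl⟩ := hk
    exact t.conv_comp_le_of_lift (isMap_coe _)

theorem sub_id (X : LAdj A) : sub (𝟙 X.as) = Rel.graphSub (𝟙 X) :=
  Rel.sub_ext fun U a b => by
    rw [sub_factors, Rel.factors_graphSub, Category.comp_id, (isMap_coe a).conv_comp_le_iff,
      Category.comp_id]
    exact ⟨fun h => Subtype.ext ((isMap_coe b).eq_of_le (isMap_coe a) h).symm, fun h => h ▸ le_rfl⟩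

/-- Composition in `A` has to match the existential quantifier over covers that defines composition
of subobjects. -/
theorem sub_comp [Regular (LAdj A)] (R : X.as ⟶ Y.as) (S : Y.as ⟶ Z.as) :
    sub (R ≫ S) = Rel.compSub (sub R) (sub S) := by
  refine Rel.sub_ext fun U a c => ?_
  simp only [Rel.factors_compSub, sub_factors]
  constructor
  · intro h
    rw [conv_comp_le_iff (isMap_coe a) (isMap_coe c)] at h
    -- `W` consists of the pairs `(u, y)` with `y` an intermediate point between `a u` and `c u`.
    -- That every `u` has such a `y` says that `e` is a cover, and `b` is the generic witness.
    obtain ⟨W, e, b, t⟩ := exists_tabulates_hom (X := U) (Y := Y) ((a.1 ≫ R) ⊓' (c.1 ≫ S†))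
    have he : e.1† ≫ e.1 = 𝟙 U.as := by
      refine le_antisymm (isMap_coe e).simple ?_
      have h₁ : 𝟙 U.as ≤ (e.1† ≫ b.1) ≫ S ≫ c.1† := by
        rw [t.conv_comp_eq]
        calc 𝟙 U.as ≤ ((a.1 ≫ R) ≫ (S ≫ c.1†)) ⊓' 𝟙 U.as := le_meet (by simpa using h) le_rfl
          _ ≤ _ := modular_right _ _ _
          _ = _ := by simp
      rw [Category.assoc] at h₁
      simpa using entire_of_le_comp h₁
    have : IsRegularEpi e := (isRegularEpi_iff e).2 he
    refine ⟨W, e, b, inferInstance, ?_, ?_⟩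
    · rw [comp_coe, conv_comp, Category.assoc, (isMap_coe a).conv_comp_le_iff, t.conv_comp_eq]
      exact meet_le_left _ _
    · rw [comp_coe, ← Category.assoc, (isMap_coe c).comp_le_iff]
      simpa using conv_mono (t.conv_comp_eq.le.trans (meet_le_right _ _))
  · rintro ⟨W, e, b, he, h₁, h₂⟩
    have : IsRegularEpi e := Regular.isRegularEpi_of_extremalEpi e
    have he := (isRegularEpi_iff e).1 this
    -- Conversely, the cover is inserted as `e† ≫ e = 𝟙`, and the witness `b` through `𝟙 ≤ b ≫ b†`.
    calc a.1† ≫ c.1 = a.1† ≫ (e.1† ≫ 𝟙 _ ≫ e.1) ≫ c.1 := by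
          rw [Category.id_comp, he, Category.id_comp]
      _ ≤ a.1† ≫ (e.1† ≫ (b.1 ≫ b.1†) ≫ e.1) ≫ c.1 := by
          gcongr
          exact (isMap_coe b).entire
      _ = ((e ≫ a).1† ≫ b.1) ≫ b.1† ≫ (e ≫ c).1 := by simp [comp_coe]
      _ ≤ R ≫ S := PoCategory.comp_mono h₁ h₂

variable (A) in
/-- The functor which sends a morphism to its tabulation. -/
noncomputable def toRel [Regular (LAdj A)] : A ⥤ Rel (LAdj A) where
  obj X := ⟨⟨X⟩⟩
  map {X Y} R := sub (X := ⟨X⟩) (Y := ⟨Y⟩) R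
  map_id X := sub_id ⟨X⟩
  map_comp {X Y Z} R S := sub_comp (X := ⟨X⟩) (Y := ⟨Y⟩) (Z := ⟨Z⟩) R S

variable (A) in
/-- A unitary tabular allegory is isomorphic to the relations of its category of maps. -/
noncomputable def poIsoRel [Regular (LAdj A)] : PoIso A (Rel (LAdj A)) := by
  have inj : ∀ {X Y : LAdj A} {R S : X.as ⟶ Y.as}, sub R = sub S → R = S := fun h =>
    le_antisymm (sub_le_sub_iff.1 h.le) (sub_le_sub_iff.1 h.ge)
  have spec : ∀ {X Y : LAdj A} (x : Subobject (X ⊗ Y)), sub (sub_surjective x).choose = x :=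
    fun x => (sub_surjective x).choose_spec
  exact
  { functor := toRel A
    inverse :=
    { obj X := X.as.as
      map {X Y} x := (sub_surjective (X := X.as) (Y := Y.as) x).choose
      map_id X := inj ((spec (X := X.as) (Y := X.as) _).trans (sub_id X.as).symm)
      map_comp {X Y Z} x y := inj (by
        rw [sub_comp, spec, spec, spec]
        rfl) }
    unit_eq := by
      refine CategoryTheory.Functor.ext (fun X => rfl) fun X Y R => ?_
      -- Objects agree definitionally, so the transport morphisms demanded by `Functor.ext` are
      -- identities.
      exact (inj (spec (X := ⟨X⟩) (Y := ⟨Y⟩) _).symm).trans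
        ((Category.id_comp (X := X) _).trans (Category.comp_id (Y := Y) _)).symm
    counit_eq := by
      refine CategoryTheory.Functor.ext (fun X => rfl) fun X Y x => ?_
      exact (spec (X := X.as) (Y := Y.as) x).trans
        ((Category.id_comp (X := X) _).trans (Category.comp_id (Y := Y) _)).symm
    functor_po h := sub_le_sub_iff.2 h
    inverse_po {X Y x y} h := by
      refine sub_le_sub_iff.1 ?_
      rw [spec, spec]
      exact h }

end Relations

end Allegory
/-! ### The hyperdoctrine of an ajax functor -/

/-! ### Identities between graphs and cographs. -/

namespace Rel

variable {C : Type u} [Category.{v} C] [CartesianMonoidalCategory C] [Regular C]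

@[simp] theorem cograph_id (X : C) : cograph (𝟙 X) = 𝟙 (Rel.mk X) :=
  ext_mem fun U a b => by
    refine mem_cograph.trans (Iff.trans ?_ mem_id.symm)
    rw [Category.comp_id, eq_comm]

theorem cograph_comp {X Y Z : C} (f : X ⟶ Y) (g : Y ⟶ Z) :
    cograph (f ≫ g) = cograph g ≫ cograph f :=
  ext_mem fun U a b => by
    rw [mem_comp_cograph]
    refine mem_cograph.trans (Iff.trans ?_ mem_cograph.symm)
    rw [Category.assoc]

theorem cograph_graph_le {X Y : C} (f : X ⟶ Y) : cograph f ≫ graph f ≤ 𝟙 (Rel.mk Y) := by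
  refine le_iff.2 fun U (a : U ⟶ Y) (c : U ⟶ Y) h => ?_
  obtain ⟨U', e, b, he, h, h'⟩ := mem_comp_graph.1 h
  exact mem_id.2 ((cancel_epi e).1 ((mem_cograph.1 h).symm.trans h'))

/-- This is the Beck–Chevalley condition at the level of relations, where it expresses the universal
property of the pullback. -/
theorem graph_cograph_of_isPullback {W X Y Z : C} {p : W ⟶ X} {q : W ⟶ Y} {f : X ⟶ Z} {g : Y ⟶ Z}
    (h : IsPullback p q f g) : graph f ≫ cograph g = cograph p ≫ graph q := by
  refine ext_mem fun U (a : U ⟶ X) (c : U ⟶ Y) => ?_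
  rw [mem_graph_comp, mem_comp_graph]
  refine mem_cograph.trans ⟨fun hac => ?_, ?_⟩
  · refine ⟨U, 𝟙 U, h.lift a c hac.symm, inferInstance, mem_cograph.2 ?_, ?_⟩ <;> simp
  · rintro ⟨U', e, b, he, h₁, h₂⟩
    have h₁ := mem_cograph.1 h₁
    rw [← cancel_epi e, ← Category.assoc, ← h₂, ← Category.assoc, ← h₁, Category.assoc,
      Category.assoc, h.w]

theorem cograph_tensorHom {X Y X' Y' : C} (f : X ⟶ Y) (g : X' ⟶ Y') :
    cograph f ⊗ₘ cograph g = cograph (f ⊗ₘ g) := by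
  refine ext_mem fun U (b : U ⟶ Y ⊗ Y') (a : U ⟶ X ⊗ X') => ?_
  obtain ⟨a₁, a₂, rfl⟩ := exists_lift a
  obtain ⟨b₁, b₂, rfl⟩ := exists_lift b
  refine mem_tensorHom'.trans (Iff.trans ?_ mem_cograph.symm)
  rw [lift_map, lift_inj]
  exact and_congr mem_cograph mem_cograph

/-- This is Frobenius reciprocity at the level of relations: both sides relate `(y, x)` to `y'`
exactly when `f x = y = y'`. -/
theorem cograph_diag_graph {X Y : C} (f : X ⟶ Y) :
    (cograph f ⊗ₘ 𝟙 (Rel.mk X)) ≫ cograph (diag X) ≫ graph f =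
      (𝟙 (Rel.mk Y) ⊗ₘ graph f) ≫ cograph (diag Y) := by
  refine ext_mem fun U (a : U ⟶ Y ⊗ X) (c : U ⟶ Y) => ?_
  obtain ⟨a₁, a₂, rfl⟩ := exists_lift a
  rw [← Category.assoc, mem_comp_graph, mem_comp_cograph, comp_lift, Category.comp_id]
  simp only [mem_comp_cograph, comp_lift, Category.comp_id]
  constructor
  · rintro ⟨U', e, b, he, h, h'⟩
    obtain ⟨h₁, h₂⟩ := mem_tensorHom'.1 h
    obtain rfl := mem_id.1 h₂
    have h₁ := mem_cograph.1 h₁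
    rw [Category.assoc] at h' h₁
    have h' := (cancel_epi e).1 h'
    have h₁ := (cancel_epi e).1 h₁
    exact mem_tensorHom'.2 ⟨mem_id.2 (h₁.symm.trans h'), mem_graph.2 h'⟩
  · intro h
    obtain ⟨h₁, h₂⟩ := mem_tensorHom'.1 h
    obtain rfl := mem_id.1 h₁
    obtain rfl := mem_graph.1 h₂
    exact ⟨U, 𝟙 U, a₂, inferInstance, mem_tensorHom'.2 ⟨mem_cograph.2 (by simp),
      mem_id.2 (by simp)⟩, by simp⟩

end Rel

/-! ### Direct and inverse images, conjunction, and equality up to a cover. -/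

section Hyperdoctrine

variable {C : Type u} [Category.{v} C] [CartesianMonoidalCategory C] [Regular C]
variable {P : Rel C ⥤ PartOrd.{w}}

/-- The inverse image of a predicate. -/
noncomputable def pull {X Y : C} (f : X ⟶ Y) (φ : P.obj ⟨Y⟩) : P.obj ⟨X⟩ := act P (Rel.cograph f) φ

/-- The direct image of a predicate. -/
noncomputable def push {X Y : C} (f : X ⟶ Y) (φ : P.obj ⟨X⟩) : P.obj ⟨Y⟩ := act P (Rel.graph f) φ

theorem pull_id {X : C} (φ : P.obj ⟨X⟩) : pull (𝟙 X) φ = φ := by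
  rw [pull, Rel.cograph_id, act_id]

theorem pull_comp {X Y Z : C} (f : X ⟶ Y) (g : Y ⟶ Z) (φ : P.obj ⟨Z⟩) :
    pull (f ≫ g) φ = pull f (pull g φ) := by
  rw [pull, Rel.cograph_comp, act_comp]; rfl

theorem push_id {X : C} (φ : P.obj ⟨X⟩) : push (𝟙 X) φ = φ := by
  rw [push, Rel.graph_id, act_id]

theorem push_comp {X Y Z : C} (f : X ⟶ Y) (g : Y ⟶ Z) (φ : P.obj ⟨X⟩) :
    push (f ≫ g) φ = push g (push f φ) := by
  rw [push, Rel.graph_comp, act_comp]; rfl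

@[gcongr]
theorem pull_mono {X Y : C} (f : X ⟶ Y) {φ ψ : P.obj ⟨Y⟩} (h : φ ≤ ψ) : pull f φ ≤ pull f ψ :=
  act_mono P _ h

@[gcongr]
theorem push_mono {X Y : C} (f : X ⟶ Y) {φ ψ : P.obj ⟨X⟩} (h : φ ≤ ψ) : push f φ ≤ push f ψ :=
  act_mono P _ h

/-- The Beck–Chevalley condition. -/
theorem pull_push_of_isPullback {W X Y Z : C} {p : W ⟶ X} {q : W ⟶ Y} {f : X ⟶ Z} {g : Y ⟶ Z}
    (h : IsPullback p q f g) (φ : P.obj ⟨X⟩) : pull g (push f φ) = push q (pull p φ) := by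
  rw [pull, push, ← act_comp, Rel.graph_cograph_of_isPullback h, act_comp]; rfl

theorem le_pull_comp {U V X : C} {α : P.obj ⟨U⟩} {β : P.obj ⟨V⟩} {e : V ⟶ U} {a : U ⟶ X}
    {φ : P.obj ⟨X⟩} (hβ : β ≤ pull e α) (h : α ≤ pull a φ) : β ≤ pull (e ≫ a) φ := by
  rw [pull_comp]
  exact hβ.trans (pull_mono e h)

/-- The generalized elements `a` and `b` of `X` are equal on `α`: they become equal on a cover. -/
def EqOn {U X : C} (α : P.obj ⟨U⟩) (a b : U ⟶ X) : Prop :=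
  ∃ (V : C) (e : V ⟶ U) (β : P.obj ⟨V⟩), push e β = α ∧ e ≫ a = e ≫ b

namespace EqOn

variable {U V X Y : C} {α : P.obj ⟨U⟩} {a b : U ⟶ X}

theorem refl (α : P.obj ⟨U⟩) (a : U ⟶ X) : EqOn α a a := ⟨U, 𝟙 U, α, push_id α, rfl⟩

theorem of_eq (α : P.obj ⟨U⟩) (h : a = b) : EqOn α a b := h ▸ refl α a

theorem symm (h : EqOn α a b) : EqOn α b a := by
  obtain ⟨V, e, β, hβ, h⟩ := h
  exact ⟨V, e, β, hβ, h.symm⟩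

theorem comp (h : EqOn α a b) (f : X ⟶ Y) : EqOn α (a ≫ f) (b ≫ f) := by
  obtain ⟨V, e, β, hβ, h⟩ := h
  exact ⟨V, e, β, hβ, by rw [reassoc_of% h]⟩

theorem of_cover {e : V ⟶ U} {β : P.obj ⟨V⟩} (hβ : push e β = α)
    (h : EqOn β (e ≫ a) (e ≫ b)) : EqOn α a b := by
  obtain ⟨W, e', γ, hγ, h⟩ := h
  exact ⟨W, e' ≫ e, γ, by rw [push_comp, hγ, hβ], by simpa using h⟩

end EqOn

variable [P.LaxBraided]

/-- The conjunction of two predicates. -/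
noncomputable def conj {X : C} (φ ψ : P.obj ⟨X⟩) : P.obj ⟨X⟩ :=
  pull (Rel.diag X) (lax P (X := ⟨X⟩) (Y := ⟨X⟩) φ ψ)

/-- The laxator is the external conjunction. By naturality of the laxator, the claim reduces to the
fact that the diagonal followed by the product of the projections is the identity. -/
theorem conj_pull_fst_snd {X Y : C} (φ : P.obj ⟨X⟩) (ψ : P.obj ⟨Y⟩) :
    conj (pull (fst X Y) φ) (pull (snd X Y) ψ) = lax P (X := ⟨X⟩) (Y := ⟨Y⟩) φ ψ := by
  have h := act_lax P (Rel.cograph (fst X Y)) (Rel.cograph (snd X Y)) φ ψ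
  rw [Rel.cograph_tensorHom] at h
  refine (congrArg (pull _) h.symm).trans
    ((pull_comp (X := X ⊗ Y) (Z := X ⊗ Y) _ _ _).symm.trans ?_)
  rw [lift_map, Category.id_comp, Category.id_comp, lift_fst_snd, pull_id]

/-- Frobenius reciprocity. -/
theorem push_conj_pull {X Y : C} (f : X ⟶ Y) (φ : P.obj ⟨Y⟩) (ψ : P.obj ⟨X⟩) :
    push f (conj (pull f φ) ψ) = conj φ (push f ψ) := by
  have h₁ : push f (conj (pull f φ) ψ) =
      act P ((Rel.cograph f ⊗ₘ 𝟙 (Rel.mk X)) ≫ Rel.cograph (Rel.diag X) ≫ Rel.graph f)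
        (lax P (X := ⟨Y⟩) (Y := ⟨X⟩) φ ψ) := by
    rw [act_comp, act_lax, act_id, act_comp]; rfl
  have h₂ : conj φ (push f ψ) =
      act P ((𝟙 (Rel.mk Y) ⊗ₘ Rel.graph f) ≫ Rel.cograph (Rel.diag Y))
        (lax P (X := ⟨Y⟩) (Y := ⟨X⟩) φ ψ) := by
    rw [act_comp, act_lax, act_id]; rfl
  rw [h₁, h₂, Rel.cograph_diag_graph]

variable [IsAjax P]

/-- The graph of `f` is left adjoint to its cograph among relations, and a po-functor preserves
adjunctions. -/
theorem push_le_iff {X Y : C} {f : X ⟶ Y} {φ : P.obj ⟨X⟩} {ψ : P.obj ⟨Y⟩} :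
    push f φ ≤ ψ ↔ φ ≤ pull f ψ := by
  constructor
  · intro h
    refine le_trans ?_ (pull_mono f h)
    rw [pull, push, ← act_comp]
    exact (act_id P φ).ge.trans (act_le_act P (Rel.le_graph_cograph f) φ)
  · intro h
    refine (push_mono f h).trans ?_
    rw [pull, push, ← act_comp]
    exact (act_le_act P (Rel.cograph_graph_le f) ψ).trans (act_id P ψ).le

theorem lax_le_pull_fst {X Y : C} (φ : P.obj ⟨X⟩) (ψ : P.obj ⟨Y⟩) :
    lax P (X := ⟨X⟩) (Y := ⟨Y⟩) φ ψ ≤ pull (fst X Y) φ := push_le_iff.1 (act_fst_le P φ ψ)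

theorem lax_le_pull_snd {X Y : C} (φ : P.obj ⟨X⟩) (ψ : P.obj ⟨Y⟩) :
    lax P (X := ⟨X⟩) (Y := ⟨Y⟩) φ ψ ≤ pull (snd X Y) ψ := push_le_iff.1 (act_snd_le P φ ψ)

theorem conj_le_left {X : C} (φ ψ : P.obj ⟨X⟩) : conj φ ψ ≤ φ := by
  refine (pull_mono _ (lax_le_pull_fst φ ψ)).trans ?_
  rw [← pull_comp, lift_fst, pull_id]

theorem conj_le_right {X : C} (φ ψ : P.obj ⟨X⟩) : conj φ ψ ≤ ψ := by
  refine (pull_mono _ (lax_le_pull_snd φ ψ)).trans ?_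
  rw [← pull_comp, lift_snd, pull_id]

theorem le_conj {X : C} {φ ψ χ : P.obj ⟨X⟩} (h₁ : χ ≤ φ) (h₂ : χ ≤ ψ) : χ ≤ conj φ ψ :=
  (le_act_diag P χ).trans (pull_mono _ (lax_mono P h₁ h₂))

theorem le_conj_iff {X : C} {φ ψ χ : P.obj ⟨X⟩} : χ ≤ conj φ ψ ↔ χ ≤ φ ∧ χ ≤ ψ :=
  ⟨fun h => ⟨h.trans (conj_le_left _ _), h.trans (conj_le_right _ _)⟩, fun h => le_conj h.1 h.2⟩

/-- Inverse image is a right adjoint, so it preserves meets. -/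
theorem pull_conj {X Y : C} (f : X ⟶ Y) (φ ψ : P.obj ⟨Y⟩) :
    pull f (conj φ ψ) = conj (pull f φ) (pull f ψ) :=
  le_antisymm (le_conj (pull_mono f (conj_le_left _ _)) (pull_mono f (conj_le_right _ _)))
    (push_le_iff.1 (le_conj (push_le_iff.2 (conj_le_left _ _)) (push_le_iff.2 (conj_le_right _ _))))

/-- The true predicate. -/
noncomputable def truth (P : Rel C ⥤ PartOrd.{w}) [P.LaxBraided] (X : C) : P.obj ⟨X⟩ :=
  pull (toUnit X) (laxUnit P)

theorem le_truth {X : C} (φ : P.obj ⟨X⟩) : φ ≤ truth P X :=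
  push_le_iff.1 (le_laxUnit P _)

/-- Covers are stable under base change. -/
theorem exists_cover {U V W : C} {α : P.obj ⟨U⟩} (e : V ⟶ U) {β : P.obj ⟨V⟩} (h : push e β = α)
    (f : W ⟶ U) {γ : P.obj ⟨W⟩} (hγ : γ ≤ pull f α) :
    ∃ (V' : C) (e' : V' ⟶ W) (f' : V' ⟶ V) (β' : P.obj ⟨V'⟩), push e' β' = γ ∧
      β' ≤ pull f' β ∧ f' ≫ e = e' ≫ f := by
  refine ⟨pullback e f, pullback.snd e f, pullback.fst e f,
    conj (pull (pullback.snd e f) γ) (pull (pullback.fst e f) β), ?_, conj_le_right _ _,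
    pullback.condition⟩
  -- Frobenius and Beck–Chevalley compute the direct image as the conjunction of `γ` with `pull f
  -- α`, which is `γ` by hypothesis.
  rw [push_conj_pull, ← pull_push_of_isPullback (IsPullback.of_hasPullback e f), h]
  exact le_antisymm (conj_le_left _ _) (le_conj le_rfl hγ)

theorem le_pull_of_push_eq {U V : C} {α : P.obj ⟨U⟩} {e : V ⟶ U} {β : P.obj ⟨V⟩}
    (h : push e β = α) : β ≤ pull e α := push_le_iff.1 h.le

/-- Truth of a predicate is local: it may be checked on a cover. -/
theorem le_pull_of_cover {U V X : C} {α : P.obj ⟨U⟩} {β : P.obj ⟨V⟩} {e : V ⟶ U} {a : U ⟶ X}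
    {φ : P.obj ⟨X⟩} (hβ : push e β = α) (h : β ≤ pull (e ≫ a) φ) : α ≤ pull a φ := by
  rw [pull_comp] at h
  rw [← hβ]
  exact push_le_iff.2 h

namespace EqOn

variable {U V X Y : C} {α : P.obj ⟨U⟩} {a b c : U ⟶ X}

theorem precomp (h : EqOn α a b) (f : V ⟶ U) {γ : P.obj ⟨V⟩} (hγ : γ ≤ pull f α) :
    EqOn γ (f ≫ a) (f ≫ b) := by
  obtain ⟨W, e, β, hβ, h⟩ := h
  obtain ⟨V', e', f', β', hβ', -, w⟩ := exists_cover e hβ f hγ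
  exact ⟨V', e', β', hβ', by rw [← reassoc_of% w, ← reassoc_of% w, h]⟩

/-- The cover witnessing the second equality is pulled back along the one witnessing the first. -/
theorem trans (h : EqOn α a b) (h' : EqOn α b c) : EqOn α a c := by
  obtain ⟨V, e, β, hβ, h⟩ := h
  refine of_cover hβ ?_
  rw [h]
  exact h'.precomp e (le_pull_of_push_eq hβ)

theorem lift {a' b' : U ⟶ Y} (h : EqOn α a b) (h' : EqOn α a' b') :
    EqOn α (lift a a') (lift b b') := by
  obtain ⟨V, e, β, hβ, h⟩ := h
  refine of_cover hβ ?_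
  obtain ⟨W, e', γ, hγ, h'⟩ := h'.precomp e (le_pull_of_push_eq hβ)
  exact ⟨W, e', γ, hγ, by rw [comp_lift, comp_lift, comp_lift, comp_lift, h, h']⟩

/-- Equals may be substituted in a predicate, since truth is local. -/
theorem le_pull {φ : P.obj ⟨X⟩} (h : EqOn α a b) (ha : α ≤ pull a φ) : α ≤ pull b φ := by
  obtain ⟨V, e, β, hβ, h⟩ := h
  refine le_pull_of_cover hβ ?_
  rw [← h]
  exact le_pull_comp (le_pull_of_push_eq hβ) ha

theorem of_fst_snd {a b : U ⟶ X ⊗ Y} (h₁ : EqOn α (a ≫ fst X Y) (b ≫ fst X Y))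
    (h₂ : EqOn α (a ≫ snd X Y) (b ≫ snd X Y)) : EqOn α a b := by
  simpa using h₁.lift h₂

end EqOn

/-- The interpretation of the existential quantifier. -/
theorem le_pull_push_iff {U X Y : C} {f : X ⟶ Y} {φ : P.obj ⟨X⟩} {α : P.obj ⟨U⟩} {a : U ⟶ Y} :
    α ≤ pull a (push f φ) ↔ ∃ (V : C) (e : V ⟶ U) (β : P.obj ⟨V⟩) (b : V ⟶ X), push e β = α ∧
      b ≫ f = e ≫ a ∧ β ≤ pull b φ := by
  constructor
  · intro h
    obtain ⟨V, e, b, β, h₁, h₂, h₃⟩ := exists_cover f rfl a h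
    exact ⟨V, e, β, b, h₁, h₃, h₂⟩
  · rintro ⟨V, e, β, b, hβ, w, h⟩
    refine le_pull_of_cover hβ ?_
    rw [← w, pull_comp]
    exact h.trans (pull_mono b (push_le_iff.1 le_rfl))

end Hyperdoctrine

/-! ### Internal relations form a unitary tabular allegory -/

namespace IntRel

variable {C : Type u} [Category.{v} C] [CartesianMonoidalCategory C] [Regular C]
variable {P : Rel C ⥤ PartOrd.{w}} [P.LaxBraided] [IsAjax P] {X Y Z : IntRel P}

/-- The predicate underlying an internal relation. -/
def toPred (θ : X ⟶ Y) : P.obj ⟨X.ctx ⊗ Y.ctx⟩ := Subtype.val θ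

/-- On `α`, the generalized elements `a` and `b` are related by `θ`. -/
def Forces {U : C} (α : P.obj ⟨U⟩) (θ : X ⟶ Y) (a : U ⟶ X.ctx) (b : U ⟶ Y.ctx) : Prop :=
  α ≤ pull (lift a b) (toPred θ)

/-- As in the Yoneda lemma, it suffices to test the generic pair: the two projections, on the
predicate `θ` itself. -/
theorem le_iff_forces {θ η : X ⟶ Y} : θ ≤ η ↔ ∀ ⦃U : C⦄ (α : P.obj ⟨U⟩) (a : U ⟶ X.ctx)
    (b : U ⟶ Y.ctx), Forces α θ a b → Forces α η a b := by
  constructor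
  · intro h U α a b hab
    exact hab.trans (pull_mono _ h)
  · intro h
    have := h (toPred θ) (fst _ _) (snd _ _)
    rw [Forces, Forces, lift_fst_snd, pull_id, pull_id] at this
    exact this le_rfl

theorem ext_forces {θ η : X ⟶ Y} (h : ∀ ⦃U : C⦄ (α : P.obj ⟨U⟩) (a : U ⟶ X.ctx)
    (b : U ⟶ Y.ctx), Forces α θ a b ↔ Forces α η a b) : θ = η :=
  le_antisymm (le_iff_forces.2 fun _ α a b => (h α a b).1)
    (le_iff_forces.2 fun _ α a b => (h α a b).2)

/-- An internal relation, from a predicate that entails those of its source and target. -/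
def ofPred (θ : P.obj ⟨X.ctx ⊗ Y.ctx⟩) (h₁ : θ ≤ pull (fst _ _) X.pred)
    (h₂ : θ ≤ pull (snd _ _) Y.pred) : X ⟶ Y :=
  (⟨θ, push_le_iff.2 h₁, push_le_iff.2 h₂⟩ : Hom X Y)

theorem toPred_le_fst (θ : X ⟶ Y) : toPred θ ≤ pull (fst _ _) X.pred :=
  push_le_iff.1 (Subtype.property θ).1

theorem toPred_le_snd (θ : X ⟶ Y) : toPred θ ≤ pull (snd _ _) Y.pred :=
  push_le_iff.1 (Subtype.property θ).2

namespace Forces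

variable {U V : C} {α : P.obj ⟨U⟩} {θ : X ⟶ Y} {a : U ⟶ X.ctx} {b : U ⟶ Y.ctx}

theorem left (h : Forces α θ a b) : α ≤ pull a X.pred := by
  refine (h.trans (pull_mono _ (toPred_le_fst θ))).trans ?_
  rw [← pull_comp, lift_fst]

theorem right (h : Forces α θ a b) : α ≤ pull b Y.pred := by
  refine (h.trans (pull_mono _ (toPred_le_snd θ))).trans ?_
  rw [← pull_comp, lift_snd]

theorem precomp (h : Forces α θ a b) {e : V ⟶ U} {β : P.obj ⟨V⟩} (hβ : β ≤ pull e α) :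
    Forces β θ (e ≫ a) (e ≫ b) := by
  rw [Forces, ← comp_lift]
  exact le_pull_comp hβ h

theorem of_cover {e : V ⟶ U} {β : P.obj ⟨V⟩} (hβ : push e β = α)
    (h : Forces β θ (e ≫ a) (e ≫ b)) : Forces α θ a b := by
  rw [Forces, ← comp_lift] at h
  exact le_pull_of_cover hβ h

end Forces

/-- The identity is a direct image along the diagonal, hence an existential statement; this is why
equality holds only up to a cover. -/
theorem forces_id {U : C} {α : P.obj ⟨U⟩} {a b : U ⟶ X.ctx} :
    Forces α (𝟙 X) a b ↔ α ≤ pull a X.pred ∧ EqOn α a b := by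
  refine le_pull_push_iff.trans ⟨?_, ?_⟩
  · rintro ⟨V, e, β, c, hβ, w, h⟩
    rw [comp_lift, comp_lift, Category.comp_id, Rel.lift_inj] at w
    obtain ⟨rfl, w⟩ := w
    exact ⟨le_pull_of_cover hβ h, V, e, β, hβ, w⟩
  · rintro ⟨h, V, e, β, hβ, w⟩
    refine ⟨V, e, β, e ≫ a, hβ, ?_, le_pull_comp (le_pull_of_push_eq hβ) h⟩
    rw [comp_lift, comp_lift, Category.comp_id, ← w]

theorem forces_comp {U : C} {α : P.obj ⟨U⟩} {θ : X ⟶ Y} {η : Y ⟶ Z} {a : U ⟶ X.ctx}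
    {c : U ⟶ Z.ctx} : Forces α (θ ≫ η) a c ↔ ∃ (V : C) (e : V ⟶ U) (β : P.obj ⟨V⟩)
      (b : V ⟶ Y.ctx), push e β = α ∧ Forces β θ (e ≫ a) b ∧ Forces β η b (e ≫ c) := by
  -- The wiring relation is a cograph followed by a graph, so the composite is the formula `∃ b,
  -- θ(a, b) ∧ η(b, c)`, with `push` as the quantifier.
  have h : toPred (θ ≫ η) = push (Rel.outer X.ctx Y.ctx Z.ctx) (pull (Rel.glue X.ctx Y.ctx Z.ctx)
      (conj (pull (fst _ _) (toPred θ)) (pull (snd _ _) (toPred η)))) := by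
    rw [conj_pull_fst_snd]
    exact act_comp P _ _ _
  have h' : ∀ {V : C} (β : P.obj ⟨V⟩) (a : V ⟶ X.ctx) (b : V ⟶ Y.ctx) (c : V ⟶ Z.ctx),
      β ≤ pull (lift a (lift b c)) (pull (Rel.glue X.ctx Y.ctx Z.ctx)
        (conj (pull (fst _ _) (toPred θ)) (pull (snd _ _) (toPred η)))) ↔
      Forces β θ a b ∧ Forces β η b c := by
    intro V β a b c
    rw [← pull_comp, pull_conj, le_conj_iff, ← pull_comp, ← pull_comp]
    simp [Forces, Rel.glue]
  rw [Forces, h, le_pull_push_iff]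
  constructor
  · rintro ⟨V, e, β, t, hβ, w, ht⟩
    obtain ⟨a', t, rfl⟩ := Rel.exists_lift t
    obtain ⟨b, c', rfl⟩ := Rel.exists_lift t
    rw [h'] at ht
    simp only [Rel.outer, comp_lift, lift_fst, lift_snd_assoc, lift_snd, Rel.lift_inj] at w
    obtain ⟨rfl, rfl⟩ := w
    exact ⟨V, e, β, b, hβ, ht⟩
  · rintro ⟨V, e, β, b, hβ, ht⟩
    refine ⟨V, e, β, lift (e ≫ a) (lift b (e ≫ c)), hβ, ?_, (h' _ _ _ _).2 ht⟩
    simp [Rel.outer]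

theorem Forces.comp {U : C} {α : P.obj ⟨U⟩} {θ : X ⟶ Y} {η : Y ⟶ Z} {a : U ⟶ X.ctx} {b : U ⟶ Y.ctx}
    {c : U ⟶ Z.ctx} (h : Forces α θ a b) (h' : Forces α η b c) : Forces α (θ ≫ η) a c :=
  forces_comp.2 ⟨U, 𝟙 U, α, b, push_id α, by simpa using h, by simpa using h'⟩

/-- The converse of an internal relation. -/
noncomputable def converse (θ : X ⟶ Y) : Y ⟶ X :=
  ofPred (pull (lift (snd _ _) (fst _ _)) (toPred θ))
    (by
      refine (pull_mono _ (toPred_le_snd θ)).trans ?_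
      rw [← pull_comp, lift_snd])
    (by
      refine (pull_mono _ (toPred_le_fst θ)).trans ?_
      rw [← pull_comp, lift_fst])

theorem forces_converse {U : C} {α : P.obj ⟨U⟩} {θ : X ⟶ Y} {a : U ⟶ X.ctx} {b : U ⟶ Y.ctx} :
    Forces α (converse θ) b a ↔ Forces α θ a b := by
  change α ≤ pull (lift b a) (pull (lift (snd _ _) (fst _ _)) (toPred θ)) ↔ _
  rw [← pull_comp, comp_lift, lift_fst, lift_snd]
  rfl

/-- The meet of two internal relations. -/
noncomputable def inter (θ η : X ⟶ Y) : X ⟶ Y :=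
  ofPred (conj (toPred θ) (toPred η)) ((conj_le_left _ _).trans (toPred_le_fst θ))
    ((conj_le_left _ _).trans (toPred_le_snd θ))

theorem forces_inter {U : C} {α : P.obj ⟨U⟩} {θ η : X ⟶ Y} {a : U ⟶ X.ctx} {b : U ⟶ Y.ctx} :
    Forces α (inter θ η) a b ↔ Forces α θ a b ∧ Forces α η a b := by
  change α ≤ pull (lift a b) (conj (toPred θ) (toPred η)) ↔ _
  rw [pull_conj, le_conj_iff]
  rfl

noncomputable instance : Allegory (IntRel P) where
  conv := converse
  meet := inter
  conv_conv θ := ext_forces fun U α a b => by rw [forces_converse, forces_converse]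
  conv_mono h := le_iff_forces.2 fun U α a b hab =>
    forces_converse.2 (le_iff_forces.1 h _ _ _ (forces_converse.1 hab))
  conv_comp θ η := ext_forces fun U α a b => by
    simp only [forces_converse, forces_comp]
    exact exists_congr fun V => exists_congr fun e => exists_congr fun β => exists_congr fun c =>
      and_congr_right fun _ => and_comm
  meet_le_left θ η := le_iff_forces.2 fun U α a b h => (forces_inter.1 h).1
  meet_le_right θ η := le_iff_forces.2 fun U α a b h => (forces_inter.1 h).2
  le_meet h₁ h₂ := le_iff_forces.2 fun U α a b h =>
    forces_inter.2 ⟨le_iff_forces.1 h₁ _ _ _ h, le_iff_forces.1 h₂ _ _ _ h⟩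
  modular θ η ζ := le_iff_forces.2 fun U α a c h => by
    obtain ⟨h, h'⟩ := forces_inter.1 h
    obtain ⟨V, e, β, b, hβ, h₁, h₂⟩ := forces_comp.1 h
    -- The same intermediate point `b` serves on both sides: it is related to `c` by `η`, and also
    -- by the converse of `θ` followed by `ζ`, through `a`.
    exact forces_comp.2 ⟨V, e, β, b, hβ, h₁, forces_inter.2 ⟨h₂,
      (forces_converse.2 h₁).comp (h'.precomp (le_pull_of_push_eq hβ))⟩⟩

theorem forces_conv {U : C} {α : P.obj ⟨U⟩} {θ : X ⟶ Y} {a : U ⟶ X.ctx} {b : U ⟶ Y.ctx} :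
    Forces α (Allegory.conv θ) b a ↔ Forces α θ a b := forces_converse

theorem forces_meet {U : C} {α : P.obj ⟨U⟩} {θ η : X ⟶ Y} {a : U ⟶ X.ctx} {b : U ⟶ Y.ctx} :
    Forces α (Allegory.meet θ η) a b ↔ Forces α θ a b ∧ Forces α η a b := forces_inter

/-- The internal relation given by the graph of a morphism of contexts. -/
noncomputable def ofHom (f : X.ctx ⟶ Y.ctx) (hf : X.pred ≤ pull f Y.pred) : X ⟶ Y :=
  ofPred (push (lift (𝟙 _) f) X.pred)
    (push_le_iff.2 (by rw [← pull_comp, lift_fst, pull_id]))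
    (push_le_iff.2 (by rwa [← pull_comp, lift_snd]))

/-- The direct image along `⟨𝟙, f⟩` is again an existential, so the equation `f a = b` is required
only on a cover. -/
theorem forces_ofHom {f : X.ctx ⟶ Y.ctx} {hf : X.pred ≤ pull f Y.pred} {U : C} {α : P.obj ⟨U⟩}
    {a : U ⟶ X.ctx} {b : U ⟶ Y.ctx} :
    Forces α (ofHom f hf) a b ↔ α ≤ pull a X.pred ∧ EqOn α (a ≫ f) b := by
  refine le_pull_push_iff.trans ⟨?_, ?_⟩
  · rintro ⟨V, e, β, c, hβ, w, h⟩
    rw [comp_lift, comp_lift, Category.comp_id, Rel.lift_inj] at w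
    obtain ⟨rfl, w⟩ := w
    exact ⟨le_pull_of_cover hβ h, V, e, β, hβ, by simpa using w⟩
  · rintro ⟨h, V, e, β, hβ, w⟩
    refine ⟨V, e, β, e ≫ a, hβ, ?_, le_pull_comp (le_pull_of_push_eq hβ) h⟩
    rw [comp_lift, comp_lift, Category.comp_id, ← w, Category.assoc]

theorem isMap_ofHom (f : X.ctx ⟶ Y.ctx) (hf : X.pred ≤ pull f Y.pred) :
    Allegory.IsMap (ofHom f hf) where
  entire := le_iff_forces.2 fun U α a b h => by
    obtain ⟨ha, hab⟩ := forces_id.1 h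
    exact (forces_ofHom.2 ⟨ha, .refl _ _⟩).comp
      (forces_conv.2 (forces_ofHom.2 ⟨hab.le_pull ha, hab.symm.comp f⟩))
  simple := le_iff_forces.2 fun U α b b' h => by
    obtain ⟨V, e, β, a, hβ, h₁, h₂⟩ := forces_comp.1 h
    obtain ⟨-, h₁'⟩ := forces_ofHom.1 (forces_conv.1 h₁)
    obtain ⟨-, h₂'⟩ := forces_ofHom.1 h₂
    exact Forces.of_cover hβ (forces_id.2 ⟨(forces_conv.1 h₁).right, h₁'.symm.trans h₂'⟩)

/-- The extension of `θ` is the product context with `θ` as its predicate, and the two projections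
tabulate `θ`. They are jointly injective because elements of a product are equal on `α` as soon as
both coordinates are; the two covers involved have a common refinement. -/
instance : Allegory.IsTabular (IntRel P) where
  exists_tabulates {X Y} θ := by
    let Z : IntRel P := ⟨X.ctx ⊗ Y.ctx, toPred θ⟩
    refine ⟨Z, ofHom (X := Z) (fst _ _) (toPred_le_fst θ),
      ofHom (X := Z) (snd _ _) (toPred_le_snd θ),
      isMap_ofHom _ _, isMap_ofHom _ _, ext_forces fun U α a b => ⟨fun h => ?_, fun h => ?_⟩,
      le_iff_forces.2 fun U α z z' h => ?_⟩
    · obtain ⟨V, e, β, z, hβ, h₁, h₂⟩ := forces_comp.1 h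
      obtain ⟨hz, h₁⟩ := forces_ofHom.1 (forces_conv.1 h₁)
      obtain ⟨-, h₂⟩ := forces_ofHom.1 h₂
      refine Forces.of_cover hβ ?_
      have := (h₁.lift h₂).le_pull (φ := toPred θ) (by simpa using hz)
      exact this
    · exact Forces.comp (Y := Z) (b := lift a b)
        (forces_conv.2 (forces_ofHom.2 ⟨h, .of_eq _ (lift_fst _ _)⟩))
        (forces_ofHom.2 ⟨h, .of_eq _ (lift_snd _ _)⟩)
    · obtain ⟨h₁, h₂⟩ := forces_meet.1 h
      refine forces_id.2 ⟨h₁.left, EqOn.of_fst_snd ?_ ?_⟩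
      · obtain ⟨V, e, β, x, hβ, h, h'⟩ := forces_comp.1 h₁
        have h := (forces_ofHom.1 h).2.trans (forces_ofHom.1 (forces_conv.1 h')).2.symm
        exact .of_cover hβ (by simpa using h)
      · obtain ⟨V, e, β, x, hβ, h, h'⟩ := forces_comp.1 h₂
        have h := (forces_ofHom.1 h).2.trans (forces_ofHom.1 (forces_conv.1 h')).2.symm
        exact .of_cover hβ (by simpa using h)

/-- Any two generalized elements of the terminal context coincide, so every endomorphism of this
object lies below the identity. -/
instance : Allegory.IsUnitary (IntRel P) where
  exists_unit := by
    refine ⟨⟨𝟙_ C, truth P _⟩, fun R => le_iff_forces.2 fun U α a b h => ?_, fun X => ?_⟩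
    · exact forces_id.2 ⟨h.left, .of_eq _ (toUnit_unique _ _)⟩
    · refine ⟨ofHom (toUnit _) ?_, (isMap_ofHom _ _).entire⟩
      exact push_le_iff.1 (le_truth _)

end IntRel

end RegLogic

theorem corollary7p21 (T : Type u) (P : RegLogic.Rel (FRg T) ⥤ PartOrd.{w}) [P.LaxBraided] [IsAjax P] :
    (∃ _ : Regular (LAdj (IntRel P)),
      ∀ [CartesianMonoidalCategory (LAdj (IntRel P))],
        Nonempty (PoIso (IntRel P) (RegLogic.Rel (LAdj (IntRel P))))) ∧
    IsRegularPoCategory (IntRel P) := by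
  have hR : Regular (LAdj (IntRel P)) := Allegory.regular_ladj
  have hP : ∀ [CartesianMonoidalCategory (LAdj (IntRel P))],
      Nonempty (PoIso (IntRel P) (RegLogic.Rel (LAdj (IntRel P)))) :=
    ⟨Allegory.poIsoRel (IntRel P)⟩
  -- The isomorphism exists for every choice of finite products; regularity as a po-category needs
  -- one such choice.
  have : CartesianMonoidalCategory (LAdj (IntRel P)) := .ofHasFiniteProducts
  exact ⟨⟨hR, hP⟩, ⟨LAdj (IntRel P), inferInstance, this, hR, hP⟩⟩
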